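/- For an integer $\epsilon\ge 1$ let $H(\epsilon)=\left\lfloor \frac{7+\sqrt{24\epsilon+1}}{2}\right\rfloor$. A *surface* is a compact connected $2$-manifold without boundary, and its Euler genus is $2-\chi$, where $\chi$ is its Euler characteristic. If a finite simple graph $G$ is embedded on a surface (the embedding need not be cellular and $G$ need not be connected), a *face* $F$ is a connected component of the complement of $G$, and $V(F)$ is the set of vertices of $G$ on the boundary of $F$. A *$k$-list* of a vertex is a set of $k$ colors assigned to it, and $G$ can be *list-colored* from given lists if it has a proper coloring in which every vertex receives a color from its own list. For integers $\epsilon\ge 1$ and $n\ge 0$ let $T(\epsilon,n)$ be the following assertion: whenever a graph $G$ with $n$ vertices is embedded on a surface of Euler genus $\epsilon$ with a distinguished face $F$, each vertex of $V(F)$ has an $(H(\epsilon)-2)$-list and each vertex of $V(G)\setminus V(F)$ has an $H(\epsilon)$-list, then $G$ can be list-colored from these lists unless $G$ contains a complete graph $K_{H(\epsilon)-1}$ all of whose vertices lie in $V(F)$. **Lemma.** Let $\epsilon\ge 1$ with $\epsilon\neq 3$. If $T(\epsilon,H(\epsilon)+1)$ holds, then $T(\epsilon,n)$ holds for every $n$.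 -/

import Mathlib

universe u v

/-- The Heawood number `H(ε) = ⌊(7 + √(24 ε + 1)) / 2⌋`. -/
noncomputable def heawood (ε : ℕ) : ℕ :=
  ⌊(7 + Real.sqrt (24 * (ε : ℝ) + 1)) / 2⌋₊

/-- A finite pure two-dimensional simplicial complex with vertex set `X`, given by its set of
triangles. Its edges are the pairs of vertices that lie in a common triangle. -/
structure TriangleComplex (X : Type v) where
  triangles : Finset (Finset X)
  card_triangle : ∀ t ∈ triangles, t.card = 3

namespace TriangleComplex

variable {X : Type v}

/-- The 1-skeleton (the graph of vertices and edges) of the complex. -/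
def skeleton (K : TriangleComplex X) : SimpleGraph X where
  Adj x y := x ≠ y ∧ ∃ t ∈ K.triangles, x ∈ t ∧ y ∈ t
  symm := ⟨fun _ _ ⟨hne, t, ht, hx, hy⟩ => ⟨hne.symm, t, ht, hy, hx⟩⟩
  loopless := ⟨fun _ h => h.1 rfl⟩

/-- The link of the vertex `x`: its vertices are the neighbours of `x`, and two of them, `y` and
`z`, are joined when `x, y, z` span a triangle of the complex. -/
def link (K : TriangleComplex X) (x : X) : SimpleGraph {y : X // K.skeleton.Adj x y} where
  Adj y z := y ≠ z ∧ ∃ t ∈ K.triangles, x ∈ t ∧ y.1 ∈ t ∧ z.1 ∈ t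
  symm := ⟨fun _ _ ⟨hne, t, ht, hx, hy, hz⟩ => ⟨hne.symm, t, ht, hx, hz, hy⟩⟩
  loopless := ⟨fun _ h => h.1 rfl⟩

end TriangleComplex

/-- A surface (compact, connected, without boundary), given by a triangulation: a finite connected
complex in which every edge lies in exactly two triangles and every vertex link is connected.
The first condition makes each link 2-regular, so the link of each vertex is a cycle, i.e. each
vertex has a disc neighbourhood. By Radó's theorem every compact surface without boundary,
orientable or not, is of this form. -/
structure ClosedSurface (X : Type v) [Fintype X] extends TriangleComplex X where
  edge_two_triangles : ∀ x y : X, toTriangleComplex.skeleton.Adj x y →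
    {t : Finset X | t ∈ triangles ∧ x ∈ t ∧ y ∈ t}.ncard = 2
  link_connected : ∀ x : X, (toTriangleComplex.link x).Connected
  connected : toTriangleComplex.skeleton.Connected

namespace ClosedSurface

variable {X : Type v} [Fintype X]

/-- The Euler characteristic: vertices minus edges plus triangles of the triangulation. -/
noncomputable def eulerChar (S : ClosedSurface X) : ℤ :=
  (Fintype.card X : ℤ) - (S.skeleton.edgeSet.ncard : ℤ) + (S.triangles.card : ℤ)

/-- The Euler genus `2 - χ`: twice the number of handles if the surface is orientable, the number
of crosscaps otherwise. -/
noncomputable def eulerGenus (S : ClosedSurface X) : ℤ := 2 - S.eulerChar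

end ClosedSurface

/-- An embedding of the graph `G` on the surface `S`: the vertices of `G` are drawn at distinct
vertices of the triangulation, and the edges of `G` along edges of the triangulation.

As the theorem quantifies over all triangulations of a surface, these are, up to
homeomorphism, all the embeddings of the finite simple graph `G` on the surface, cellular or not,
for `G` connected or not: given such an embedding, the complement of `G` can be
triangulated, with new vertices in the complement only, and finely enough that a simplicial complex
with the edges of `G` among its edges results (no edge of `G` needs to be subdivided, since `G` has
no loops and no multiple edges). `SimpleGraph.Copy` is an injective graph homomorphism. -/
abbrev SurfaceEmbedding {V : Type u} (G : SimpleGraph V) {X : Type v} [Fintype X]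
    (S : ClosedSurface X) : Type (max u v) :=
  SimpleGraph.Copy G S.skeleton

namespace SurfaceEmbedding

variable {V : Type u} {G : SimpleGraph V} {X : Type v} [Fintype X] {S : ClosedSurface X}

/-- The edge `xy` of the triangulation is (the drawing of) an edge of `G`. -/
def IsDrawn (φ : SurfaceEmbedding G S) (x y : X) : Prop :=
  ∃ u w : V, G.Adj u w ∧ φ u = x ∧ φ w = y

/-- Two triangles are neighbours when they share an edge of the triangulation that is not an edge
of `G`, so that one can cross from one to the other without meeting `G`. -/
def crossing (φ : SurfaceEmbedding G S) : SimpleGraph {t : Finset X // t ∈ S.triangles} where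
  Adj t t' := t ≠ t' ∧
    ∃ x y : X, x ≠ y ∧ x ∈ t.1 ∧ y ∈ t.1 ∧ x ∈ t'.1 ∧ y ∈ t'.1 ∧ ¬ IsDrawn φ x y
  symm := ⟨fun _ _ ⟨hne, x, y, hxy, h1, h2, h3, h4, h5⟩ =>
    ⟨hne.symm, x, y, hxy, h3, h4, h1, h2, h5⟩⟩
  loopless := ⟨fun _ h => h.1 rfl⟩

/-- The faces of the embedding, i.e. the connected components of the complement of the drawing of
`G` in the surface, each recorded by the triangles that it contains. (All triangles around a
vertex of the triangulation that is not a vertex of `G` are in the same face, because no edge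
there belongs to `G`.) -/
abbrev Face (φ : SurfaceEmbedding G S) : Type v := φ.crossing.ConnectedComponent

/-- The vertex `w` of `G` lies on the face `F`, i.e. on its boundary: `w` is a corner of some
triangle of `F`. The set of these vertices is `V(F)`. -/
def OnFace (φ : SurfaceEmbedding G S) (F : Face φ) (w : V) : Prop :=
  ∃ t : {t : Finset X // t ∈ S.triangles}, φ.crossing.connectedComponentMk t = F ∧ φ w ∈ t.1

end SurfaceEmbedding

/-- The graph `G` can be `L`-list-colored: it has a proper coloring with the color of each vertex
taken from its list. -/
def ListColorable {V : Type u} (G : SimpleGraph V) (L : V → Finset ℕ) : Prop :=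
  ∃ c : G.Coloring ℕ, ∀ w : V, c w ∈ L w

/-- The assertion, for Euler genus `ε` and graphs with `n` vertices: whenever a graph `G` with `n`
vertices is embedded on a surface of Euler genus `ε` with a distinguished face `F`, the vertices of
`F` have lists of size `H(ε) - 2` and all other vertices have lists of size `H(ε)`, then `G` can be
colored from these lists unless `G` contains a complete graph on `H(ε) - 1` vertices, all of which
lie on `F`. (Natural subtraction is harmless: `H(ε) ≥ 4`.) -/
def HeawoodListProperty (ε n : ℕ) : Prop :=
  ∀ (V : Type u) [Fintype V] (G : SimpleGraph V), Fintype.card V = n →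
    ∀ (X : Type v) [Fintype X] (S : ClosedSurface X), S.eulerGenus = (ε : ℤ) →
      ∀ (φ : SurfaceEmbedding G S) (F : φ.Face) (L : V → Finset ℕ),
        (∀ w : V, φ.OnFace F w → (L w).card = heawood ε - 2) →
        (∀ w : V, ¬ φ.OnFace F w → (L w).card = heawood ε) →
        (¬ ∃ s : Finset V, G.IsNClique (heawood ε - 1) s ∧ ∀ w ∈ s, φ.OnFace F w) →
        ListColorable G L

/-! Write `H` for `heawood ε`. Take a minimal set `W` that cannot be colored and let `A` be its part
on `F`. By minimality every vertex has at least as many neighbours in `W` as colors, so the degrees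
in `W` sum to at least `H|W| - 2|A|`. Euler's formula, improved by the fact that one face meets all
of `A`, bounds the sum by `6|W| + 6ε - 6 - 2|A|` (`sum_degreeIn_le`). The terms in `|A|` cancel,
which is what lists shorter by two on `F` are for.

If `(H - 6)|W| ≥ 6ε - 6`, all these inequalities are equalities (`not_listCritical_of_tight`):
degrees equal list sizes, all faces but one are triangles, and that one passes each vertex at most
once. A critical set has no induced `K₄` minus an edge on vertices of degree at most their list size
(`ListCritical.adj_of_diamond`), so going around a vertex one finds that its neighbours are pairwise
adjacent. A closed neighbourhood is then a `K_{H+1}`, which has too many edges for the surface, or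
lies in `A` and is the excluded `K_{H-1}`.

A coloring argument shows `|W| > H` (`not_listCritical_of_card_le`). The arithmetic of `H`, with `ε
≠ 3`, then leaves only `|W| = H + 1` and `H ≥ 10`, where the degrees exceed the list sizes by at
most 4 in total. Here Hall's theorem gives `|A| ≥ H` (`not_listCritical_of_card_lt`), and a search
for an induced diamond gives `|A| < H` (`not_listCritical_of_sum_le`).

The topology is reduced to linear algebra modulo 2 (`ClosedSurface.euler_inequality`) and to parity
counts of face corners around a vertex. Only an inequality of Euler type is needed, so embeddings
may be noncellular. -/

open scoped Classical in
/-- The number of neighbours of `v` in `W`. -/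
noncomputable def degreeIn {V : Type u} (G : SimpleGraph V) (W : Finset V) (v : V) : ℕ :=
  (W.filter (G.Adj v)).card

/-- The subgraph induced on `W` can be colored from the lists `L`. -/
def ListColorableOn {V : Type u} (G : SimpleGraph V) (L : V → Finset ℕ) (W : Finset V) : Prop :=
  ∃ c : V → ℕ, (∀ v ∈ W, c v ∈ L v) ∧ ∀ u ∈ W, ∀ v ∈ W, G.Adj u v → c u ≠ c v

/-- `W` is a minimal set of vertices that cannot be colored from the lists `L`. -/
def ListCritical {V : Type u} (G : SimpleGraph V) (L : V → Finset ℕ) (W : Finset V) : Prop :=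
  ¬ ListColorableOn G L W ∧ ∀ W' ⊂ W, ListColorableOn G L W'

/-! ### List colorings of critical sets: greedy extension, diamonds, Hall's theorem. -/

section Coloring

open scoped Classical

variable {V : Type u} {G : SimpleGraph V} {L : V → Finset ℕ} {W : Finset V}

theorem listColorableOn_empty : ListColorableOn G L ∅ := ⟨fun _ => 0, by simp, by simp⟩

theorem ListColorableOn.mono_lists {L' : V → Finset ℕ} (h : ListColorableOn G L W)
    (hL : ∀ v ∈ W, L v ⊆ L' v) : ListColorableOn G L' W := by
  obtain ⟨c, h1, h2⟩ := h
  exact ⟨c, fun v hv => hL v hv (h1 v hv), h2⟩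

theorem exists_listCritical_subset (h : ¬ ListColorableOn G L W) :
    ∃ W' ⊆ W, ListCritical G L W' := by
  induction W using Finset.strongInduction with
  | H W ih =>
    by_cases hW : ∀ W' ⊂ W, ListColorableOn G L W'
    · exact ⟨W, subset_rfl, h, hW⟩
    · push Not at hW
      obtain ⟨W', hW', hc⟩ := hW
      obtain ⟨W'', h1, h2⟩ := ih W' hW' hc
      exact ⟨W'', h1.trans hW'.1, h2⟩

/-- A coloring of `W \ D` extends to `W` if `D` can be colored from what is left of the lists. -/
theorem ListColorableOn.extend {D : Finset V} {c : V → ℕ} (h1 : ∀ v ∈ W \ D, c v ∈ L v)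
    (h2 : ∀ u ∈ W \ D, ∀ v ∈ W \ D, G.Adj u v → c u ≠ c v)
    (hD : ListColorableOn G (fun v => L v \ ((W \ D).filter (G.Adj v)).image c) D) :
    ListColorableOn G L W := by
  obtain ⟨d, h3, h4⟩ := hD
  refine ⟨fun v => if v ∈ D then d v else c v, fun v hv => ?_, fun u hu v hv huv => ?_⟩
  · by_cases hvD : v ∈ D
    · simp only [hvD, if_true]
      exact (Finset.mem_sdiff.1 (h3 v hvD)).1
    · simp only [hvD, if_false]
      exact h1 v (by simp [hv, hvD])
  · have key : ∀ a ∈ D, ∀ b ∈ W, b ∉ D → G.Adj a b → d a ≠ c b := by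
      intro a ha b hb hbD hab heq
      have := (Finset.mem_sdiff.1 (h3 a ha)).2
      apply this
      rw [heq]
      exact Finset.mem_image_of_mem _ (by simp [hb, hbD, hab])
    by_cases huD : u ∈ D <;> by_cases hvD : v ∈ D <;> simp only [huD, hvD, if_true, if_false]
    · exact h4 u huD v hvD huv
    · exact key u huD v hv hvD huv
    · exact (key v hvD u hu huD huv.symm).symm
    · exact h2 u (by simp [hu, huD]) v (by simp [hv, hvD]) huv

theorem ListColorableOn.insert {v : V} (h : ListColorableOn G L W)
    (hd : degreeIn G W v < (L v).card) : ListColorableOn G L (insert v W) := by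
  by_cases hv : v ∈ W
  · rwa [Finset.insert_eq_of_mem hv]
  obtain ⟨c, h1, h2⟩ := h
  have e : (Insert.insert v W) \ {v} = W := by
    ext a; simp only [Finset.mem_sdiff, Finset.mem_insert, Finset.mem_singleton]; grind
  refine ListColorableOn.extend (D := {v}) (c := c) (by rwa [e]) (by rwa [e]) ?_
  rw [e]
  have : ((L v) \ (W.filter (G.Adj v)).image c).Nonempty := by
    rw [← Finset.card_pos]
    have h3 := Finset.le_card_sdiff ((W.filter (G.Adj v)).image c) (L v)
    have h4 : ((W.filter (G.Adj v)).image c).card ≤ degreeIn G W v := Finset.card_image_le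
    omega
  obtain ⟨z, hz⟩ := this
  refine ⟨fun _ => z, by simpa using hz, ?_⟩
  intro a ha b hb hab
  simp only [Finset.mem_singleton] at ha hb
  subst ha hb
  exact (G.loopless.irrefl _ hab).elim

theorem degreeIn_mono {W' : Finset V} (h : W ⊆ W') (v : V) : degreeIn G W v ≤ degreeIn G W' v :=
  Finset.card_le_card (Finset.filter_subset_filter _ h)

theorem degreeIn_le_card (W : Finset V) (v : V) : degreeIn G W v ≤ W.card :=
  Finset.card_le_card (Finset.filter_subset _ _)

/-- Greedy coloring: whatever the order, a new vertex has fewer than `W.card` colored neighbours.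
Starting from `W₀` allows vertices with shorter lists to be treated first. -/
theorem ListColorableOn.of_card_le {W₀ : Finset V} (h : ListColorableOn G L W₀) (hW : W₀ ⊆ W)
    (hL : ∀ v ∈ W \ W₀, W.card ≤ (L v).card) : ListColorableOn G L W := by
  induction W using Finset.strongInduction with
  | H W ih =>
    by_cases hne : (W \ W₀).Nonempty
    · obtain ⟨v, hv⟩ := hne
      have hv' := Finset.mem_sdiff.1 hv
      have hlt := Finset.erase_ssubset hv'.1
      have hcard := Finset.card_lt_card hlt
      have := ih (W.erase v) hlt (fun a ha => Finset.mem_erase.2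
        ⟨fun h => hv'.2 (h ▸ ha), hW ha⟩) (fun a ha => by
          have ha' := Finset.mem_sdiff.1 ha
          have := hL a (Finset.mem_sdiff.2 ⟨Finset.mem_of_mem_erase ha'.1, ha'.2⟩)
          omega)
      rw [← Finset.insert_erase hv'.1]
      apply this.insert
      have h1 := degreeIn_le_card (G := G) (W.erase v) v
      have h2 := hL v hv
      omega
    · rw [Finset.not_nonempty_iff_eq_empty, Finset.sdiff_eq_empty_iff_subset] at hne
      rwa [Finset.Subset.antisymm hne hW]

/-- Two nonadjacent vertices may be given the same color. -/
theorem ListColorableOn.of_common_color {x y : V} {z : ℕ} (hxy : ¬ G.Adj x y) (hx : z ∈ L x)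
    (hy : z ∈ L y)
    (h : ListColorableOn G (fun v => (L v).erase z) (W \ {x, y})) : ListColorableOn G L W := by
  obtain ⟨c, h1, h2⟩ := h
  refine ⟨fun v => if v = x ∨ v = y then z else c v, fun v hv => ?_, fun u hu v hv huv => ?_⟩
  · by_cases h : v = x ∨ v = y
    · simp only [h, if_true]; rcases h with rfl | rfl <;> assumption
    · simp only [h, if_false]
      exact Finset.mem_of_mem_erase (h1 v (by simp [hv]; tauto))
  · have key : ∀ a ∈ W, ¬ (a = x ∨ a = y) → c a ≠ z := fun a ha h =>
      Finset.ne_of_mem_erase (h1 a (by simp [ha]; tauto))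
    by_cases h : u = x ∨ u = y <;> by_cases h' : v = x ∨ v = y <;>
      simp only [h, h', if_true, if_false]
    · have := huv.symm
      have := huv.ne
      grind
    · exact (key v hv h').symm
    · exact key u hu h
    · exact h2 u (by simp [hu]; tauto) v (by simp [hv]; tauto) huv

theorem ListCritical.card_le_degreeIn (h : ListCritical G L W) {v : V} (hv : v ∈ W) :
    (L v).card ≤ degreeIn G W v := by
  by_contra! hlt
  apply h.1
  have := (h.2 _ (Finset.erase_ssubset hv)).insert
    (lt_of_le_of_lt (degreeIn_mono (Finset.erase_subset v W) v) hlt)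
  rwa [Finset.insert_erase hv] at this

theorem degreeIn_lt_card {v : V} (hv : v ∈ W) : degreeIn G W v < W.card :=
  Finset.card_lt_card ⟨Finset.filter_subset _ _, fun h =>
    G.loopless.irrefl v (Finset.mem_filter.1 (h hv)).2⟩

theorem adj_of_card_le_degreeIn_add_one {v w : V} (hv : v ∈ W) (hd : W.card ≤ degreeIn G W v + 1)
    (hw : w ∈ W) (hvw : v ≠ w) : G.Adj v w := by
  by_contra hn
  have hsub : W.filter (G.Adj v) ⊆ (W.erase v).erase w := by
    intro a ha
    rw [Finset.mem_filter] at ha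
    simp only [Finset.mem_erase]
    exact ⟨fun h => hn (h ▸ ha.2), ha.2.ne', ha.1⟩
  have := Finset.card_le_card hsub
  rw [Finset.card_erase_of_mem (Finset.mem_erase.2 ⟨hvw.symm, hw⟩),
    Finset.card_erase_of_mem hv] at this
  have h2 : 1 < W.card := Finset.one_lt_card.2 ⟨v, hv, w, hw, hvw⟩
  unfold degreeIn at hd
  omega

theorem listColorableOn_triple {w u q : V} (hw : 3 ≤ (L w).card) (hu : 2 ≤ (L u).card)
    (hq : 1 ≤ (L q).card) : ListColorableOn G L {w, u, q} := by
  refine ((listColorableOn_empty.insert ?_).insert ?_).insert ?_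
  · exact (degreeIn_le_card _ _).trans_lt (by simpa using hq)
  · exact (degreeIn_le_card _ _).trans_lt (by simpa using (by omega : 1 < (L u).card))
  · exact (degreeIn_le_card _ _).trans_lt (Finset.card_le_two.trans_lt hw)

/-- A diamond in which some color of `p` is not available at `w` can be colored. -/
theorem listColorableOn_diamond_of_notMem {w u p q : V} {z : ℕ} (hpq : ¬ G.Adj p q)
    (hzp : z ∈ L p) (hzw : z ∉ L w)
    (hw : 3 ≤ (L w).card) (hu : 3 ≤ (L u).card) (hq : 1 ≤ (L q).card) (hwp : w ≠ p) (hup : u ≠ p)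
    (hqp : q ≠ p) : ListColorableOn G L {w, u, p, q} := by
  have e : ({w, u, p, q} : Finset V) \ {w, u, q} = {p} := by
    ext a; simp only [Finset.mem_sdiff, Finset.mem_insert, Finset.mem_singleton]; grind
  refine ListColorableOn.extend (D := {w, u, q}) (c := fun _ => z) ?_ ?_ ?_
  · rw [e]; simpa using hzp
  · rw [e]
    intro a ha b hb hab
    simp only [Finset.mem_singleton] at ha hb
    subst ha hb
    exact (G.loopless.irrefl _ hab).elim
  · rw [e]
    have hz : ∀ v, (({p} : Finset V).filter (G.Adj v)).image (fun _ => z) ⊆ {z} := by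
      intro v a ha
      obtain ⟨_, _, rfl⟩ := Finset.mem_image.1 ha
      simp
    apply listColorableOn_triple
    · refine hw.trans (Finset.card_le_card fun a ha => Finset.mem_sdiff.2 ⟨ha, fun h => ?_⟩)
      have := Finset.mem_singleton.1 (hz _ h)
      exact hzw (this ▸ ha)
    · have h1 := Finset.le_card_sdiff ((({p} : Finset V).filter (G.Adj u)).image (fun _ => z)) (L u)
      have h2 := Finset.card_le_card (hz u)
      simp only [Finset.card_singleton] at h2
      omega
    · refine hq.trans (Finset.card_le_card fun a ha => Finset.mem_sdiff.2 ⟨ha, fun h => ?_⟩)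
      obtain ⟨b, hb, _⟩ := Finset.mem_image.1 h
      rw [Finset.mem_filter, Finset.mem_singleton] at hb
      exact hpq (hb.1 ▸ hb.2.symm)

/-- The diamond, `K₄` minus the edge `pq`, can be colored from lists at least as large as the
degrees. -/
theorem listColorableOn_diamond {w u p q : V} (hpq : ¬ G.Adj p q) (hne : p ≠ q)
    (hw : 3 ≤ (L w).card) (hu : 3 ≤ (L u).card) (hp : 2 ≤ (L p).card) (hq : 2 ≤ (L q).card)
    (hwp : w ≠ p) (hwq : w ≠ q) (hup : u ≠ p) (huq : u ≠ q) :
    ListColorableOn G L {w, u, p, q} := by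
  by_cases hc : ∃ z, z ∈ L p ∧ z ∈ L q
  · obtain ⟨z, hzp, hzq⟩ := hc
    refine ListColorableOn.of_common_color hpq hzp hzq ?_
    refine ListColorableOn.of_card_le listColorableOn_empty (Finset.empty_subset _) ?_
    intro v hv
    have hsub : ({w, u, p, q} : Finset V) \ {p, q} ⊆ {w, u} := by
      intro a ha; simp at ha ⊢; tauto
    have h1 := (Finset.card_le_card hsub).trans Finset.card_le_two
    have h2 := Finset.pred_card_le_card_erase (s := L v) (a := z)
    have h3 : v ∈ ({w, u} : Finset V) := hsub (by simpa using hv)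
    simp only [Finset.mem_insert, Finset.mem_singleton] at h3
    rcases h3 with rfl | rfl <;> omega
  -- The lists of `p` and `q` are disjoint and have together at least four colors. Cutting the list
  -- of `w` down to exactly three makes one of these useless at `w`; spending it on `p` or `q` costs
  -- `w` nothing.
  · obtain ⟨M, hM, hM3⟩ := Finset.exists_subset_card_eq hw
    suffices h : ListColorableOn G (fun v => if v = w then M else L v) {w, u, p, q} by
      refine h.mono_lists fun v _ => ?_
      by_cases hv : v = w
      · simpa [hv] using hM
      · simp [hv]
    have hMp : (if p = w then M else L p) = L p := if_neg hwp.symm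
    have hMq : (if q = w then M else L q) = L q := if_neg hwq.symm
    have hMu : 3 ≤ (if u = w then M else L u).card := by split_ifs <;> omega
    have hdisj : Disjoint (L p) (L q) := Finset.disjoint_left.2 fun a ha hb => hc ⟨a, ha, hb⟩
    have hcard := Finset.card_union_of_disjoint hdisj
    obtain ⟨z, hz, hzM⟩ := Finset.exists_mem_notMem_of_card_lt_card
      (show M.card < (L p ∪ L q).card by omega)
    rcases Finset.mem_union.1 hz with hz | hz
    · exact listColorableOn_diamond_of_notMem (z := z) hpq (by simpa only [hMp] using hz)
        (by simpa using hzM) (by simp [hM3]) hMu (by simp only [hMq]; omega) hwp hup hne.symm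
    · have := listColorableOn_diamond_of_notMem (G := G) (L := fun v => if v = w then M else L v)
        (w := w) (u := u) (p := q) (q := p) (z := z)
        (fun h => hpq h.symm) (by simpa only [hMq] using hz)
        (by simpa using hzM) (by simp [hM3]) hMu (by simp only [hMp]; omega) hwq huq hne
      rwa [Finset.pair_comm q p] at this

/-- A critical set contains no induced diamond on vertices whose lists are as large as their
degrees. -/
theorem ListCritical.adj_of_diamond (h : ListCritical G L W) {w u p q : V} (hw : w ∈ W)
    (hu : u ∈ W) (hp : p ∈ W) (hq : q ∈ W) (hLw : degreeIn G W w ≤ (L w).card)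
    (hLu : degreeIn G W u ≤ (L u).card) (hLp : degreeIn G W p ≤ (L p).card)
    (hLq : degreeIn G W q ≤ (L q).card) (hwu : G.Adj w u) (hwp : G.Adj w p) (hwq : G.Adj w q)
    (hup : G.Adj u p) (huq : G.Adj u q) (hpq : p ≠ q) : G.Adj p q := by
  by_contra hn
  set D : Finset V := {w, u, p, q} with hD
  have hDW : D ⊆ W := by
    intro a ha
    simp only [hD, Finset.mem_insert, Finset.mem_singleton] at ha
    rcases ha with rfl | rfl | rfl | rfl <;> assumption
  obtain ⟨c, h1, h2⟩ := h.2 (W \ D) (Finset.sdiff_ssubset hDW ⟨w, by simp [hD]⟩)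
  -- Each colored neighbour outside `D` costs one color, so a vertex whose list is as large as its
  -- degree keeps a color for each of its neighbours in `D`.
  have key : ∀ v, ∀ E ⊆ D, (∀ a ∈ E, G.Adj v a) → degreeIn G W v ≤ (L v).card →
      E.card ≤ (L v \ ((W \ D).filter (G.Adj v)).image c).card := by
    intro v E hED hE hv
    have h3 := Finset.le_card_sdiff (((W \ D).filter (G.Adj v)).image c) (L v)
    have h4 : (((W \ D).filter (G.Adj v)).image c).card ≤ ((W \ D).filter (G.Adj v)).card :=
      Finset.card_image_le
    have h5 : ((W \ D).filter (G.Adj v)).card + E.card ≤ degreeIn G W v := by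
      rw [← Finset.card_union_of_disjoint]
      · apply Finset.card_le_card
        intro a ha
        rcases Finset.mem_union.1 ha with ha | ha
        · simp only [Finset.mem_filter, Finset.mem_sdiff] at ha ⊢
          exact ⟨ha.1.1, ha.2⟩
        · exact Finset.mem_filter.2 ⟨hDW (hED ha), hE a ha⟩
      · exact Finset.disjoint_left.2 fun a ha hb =>
          (Finset.mem_sdiff.1 (Finset.mem_filter.1 ha).1).2 (hED hb)
    omega
  apply h.1
  refine ListColorableOn.extend h1 h2 ?_
  refine listColorableOn_diamond hn hpq ?_ ?_ ?_ ?_ hwp.ne hwq.ne hup.ne huq.ne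
  · refine le_trans ?_ (key w {u, p, q} (by simp [hD]) (by simp [hwu, hwp, hwq]) hLw)
    rw [Finset.card_eq_three.2 ⟨u, p, q, hup.ne, huq.ne, hpq, rfl⟩]
  · refine le_trans ?_ (key u {w, p, q} ?_ (by simp [hwu.symm, hup, huq]) hLu)
    · rw [Finset.card_eq_three.2 ⟨w, p, q, hwp.ne, hwq.ne, hpq, rfl⟩]
    · intro a ha; simp [hD] at ha ⊢; tauto
  · refine le_trans ?_ (key p {w, u} ?_ (by simp [hwp.symm, hup.symm]) hLp)
    · rw [Finset.card_pair hwu.ne]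
    · intro a ha; simp [hD] at ha ⊢; tauto
  · refine le_trans ?_ (key q {w, u} ?_ (by simp [hwq.symm, huq.symm]) hLq)
    · rw [Finset.card_pair hwu.ne]
    · intro a ha; simp [hD] at ha ⊢; tauto

/-- Hall's theorem, for lists such that nonadjacent vertices have no common color. -/
theorem listColorableOn_of_disjoint {A : Finset V} {H : ℕ} (hH : 5 ≤ H) (hW : W.card ≤ H + 1)
    (hLA : ∀ v ∈ A, (L v).card = H - 2) (hLB : ∀ v ∈ W, v ∉ A → (L v).card = H)
    (hdisj : ∀ x ∈ W, ∀ y ∈ W, x ≠ y → ¬ G.Adj x y → Disjoint (L x) (L y))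
    (hA : ∀ s ⊆ A, ¬ G.IsNClique (H - 1) s) (hWc : ¬ G.IsNClique (H + 1) W) :
    ListColorableOn G L W := by
  obtain ⟨f, hf, hfL⟩ := (Finset.all_card_le_biUnion_card_iff_exists_injective
    (fun v : {v // v ∈ W} => L v.1)).1 (by
      intro s
      have hsW : s.card ≤ W.card := by simpa using Finset.card_le_univ s
      have hmem : ∀ v ∈ s, (L v.1).card ≤ (s.biUnion fun v => L v.1).card := fun v hv =>
        Finset.card_le_card (Finset.subset_biUnion_of_mem (fun v : {v // v ∈ W} => L v.1) hv)
      -- A nonadjacent pair has disjoint lists, hence at least `2(H - 2) ≥ H + 1` colors; this is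
      -- where `5 ≤ H` enters.
      by_cases h1 : ∃ x ∈ s, ∃ y ∈ s, x ≠ y ∧ ¬ G.Adj x.1 y.1
      · obtain ⟨x, hx, y, hy, hxy, hadj⟩ := h1
        have h2 := Finset.card_union_of_disjoint
          (hdisj x.1 x.2 y.1 y.2 (fun h => hxy (Subtype.ext h)) hadj)
        have h3 : (L x.1 ∪ L y.1).card ≤ (s.biUnion fun v => L v.1).card :=
          Finset.card_le_card (Finset.union_subset
            (Finset.subset_biUnion_of_mem (fun v : {v // v ∈ W} => L v.1) hx)
            (Finset.subset_biUnion_of_mem (fun v : {v // v ∈ W} => L v.1) hy))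
        have h4 : ∀ v ∈ W, H - 2 ≤ (L v).card := fun v hv => by
          by_cases h : v ∈ A
          · exact (hLA v h).ge
          · have := hLB v hv h; omega
        have := h4 x.1 x.2
        have := h4 y.1 y.2
        omega
      · push Not at h1
        have hcl : G.IsClique (s.image Subtype.val : Finset V) := by
          intro a ha b hb hab
          simp only [Finset.coe_image, Set.mem_image, Finset.mem_coe] at ha hb
          obtain ⟨a, ha, rfl⟩ := ha
          obtain ⟨b, hb, rfl⟩ := hb
          exact h1 a ha b hb (fun h => hab (h ▸ rfl))
        have hcard : (s.image Subtype.val).card = s.card :=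
          Finset.card_image_of_injective _ Subtype.val_injective
        have hsub : s.image Subtype.val ⊆ W := by
          intro a ha
          obtain ⟨b, _, rfl⟩ := Finset.mem_image.1 ha
          exact b.2
        -- For a clique one list suffices: inside `A` it has at most `H - 2` vertices; otherwise it
        -- has at most `H`, since `H + 1` vertices would be all of `W`.
        by_cases h2 : s.image Subtype.val ⊆ A
        · rcases s.eq_empty_or_nonempty with rfl | ⟨v, hv⟩
          · simp
          have h3 := hmem v hv
          rw [hLA v.1 (h2 (Finset.mem_image_of_mem _ hv))] at h3
          by_contra h4
          obtain ⟨t, ht, htc⟩ := Finset.exists_subset_card_eq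
            (show H - 1 ≤ (s.image Subtype.val).card by omega)
          exact hA t (ht.trans h2) ⟨hcl.subset (by exact_mod_cast ht), htc⟩
        · obtain ⟨v, hv, hvA⟩ := Finset.not_subset.1 h2
          obtain ⟨v, hvs, rfl⟩ := Finset.mem_image.1 hv
          have h3 := hmem v hvs
          rw [hLB v.1 v.2 hvA] at h3
          by_contra h4
          have h5 : s.image Subtype.val = W := Finset.eq_of_subset_of_card_le hsub (by omega)
          exact hWc ⟨h5 ▸ hcl, by omega⟩)
  refine ⟨fun v => if hv : v ∈ W then f ⟨v, hv⟩ else 0, fun v hv => ?_, fun u hu v hv huv => ?_⟩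
  · simpa [hv] using hfL ⟨v, hv⟩
  · simp only [hu, hv, dif_pos]
    exact fun h => huv.ne (congrArg Subtype.val (hf h))

end Coloring

/-! ### Critical sets with lists of sizes `H` and `H - 2`. -/

section HeawoodLists

open scoped Classical

variable {V : Type u} {G : SimpleGraph V} {L : V → Finset ℕ} {W A : Finset V} {H : ℕ}

theorem isClique_of_card_le_degreeIn (h : ∀ v ∈ W, W.card ≤ degreeIn G W v + 1) :
    G.IsClique (W : Set V) :=
  fun v hv _ hw hvw => adj_of_card_le_degreeIn_add_one hv (h v hv) hw hvw

theorem card_sdiff_pair {x y : V} (hx : x ∈ W) (hy : y ∈ W) (hxy : x ≠ y) :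
    (W \ {x, y}).card + 2 = W.card := by
  have h : ({x, y} : Finset V) ⊆ W := by
    intro a ha; simp at ha; rcases ha with rfl | rfl <;> assumption
  have := Finset.card_sdiff_add_card_eq_card h
  rwa [Finset.card_pair hxy] at this

/-- The number of vertices of `W` other than `v` that are not adjacent to `v`. -/
theorem card_nonadj_add_degreeIn {v : V} (hv : v ∈ W) :
    ((W.erase v).filter fun a => ¬ G.Adj v a).card + degreeIn G W v + 1 = W.card := by
  have h1 := Finset.card_filter_add_card_filter_not (s := W.erase v) (p := G.Adj v)
  have h2 : (W.erase v).filter (G.Adj v) = W.filter (G.Adj v) := by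
    ext a
    simp only [Finset.mem_filter, Finset.mem_erase]
    exact ⟨fun h => ⟨h.1.2, h.2⟩, fun h => ⟨⟨h.2.ne', h.1⟩, h.2⟩⟩
  rw [h2] at h1
  have := Finset.card_erase_add_one hv
  unfold degreeIn
  omega

/-- With at most `H` vertices no degree reaches `H`, so `W = A`. The degrees are at least `H - 2`,
so `|W| = H - 1` would give a forbidden clique. Hence `|W| = H` and each vertex misses at most one
other. A color common to two nonadjacent vertices is given to both; if there is none, Hall's theorem
applies. -/
theorem not_listCritical_of_card_le (hH : 6 ≤ H) (hc : ListCritical G L W) (hA : A ⊆ W)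
    (hLA : ∀ v ∈ A, (L v).card = H - 2) (hLB : ∀ v ∈ W, v ∉ A → (L v).card = H)
    (hcl : ∀ s ⊆ A, ¬ G.IsNClique (H - 1) s) : H < W.card := by
  by_contra! hW
  have hWA : W = A := by
    refine Finset.Subset.antisymm (fun v hv => ?_) hA
    by_contra hvA
    have h1 := hc.card_le_degreeIn hv
    have h2 := degreeIn_lt_card (G := G) hv
    have h3 := hLB v hv hvA
    omega
  subst hWA
  have hdeg : ∀ v ∈ W, H - 2 ≤ degreeIn G W v := fun v hv => by
    have h1 := hc.card_le_degreeIn hv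
    rwa [hLA v hv] at h1
  have hnoclique : ∀ s ⊆ W, H - 1 ≤ s.card → ¬ G.IsClique (s : Set V) := by
    intro s hs hcard hcl'
    obtain ⟨t, ht, htc⟩ := Finset.exists_subset_card_eq hcard
    exact hcl t (ht.trans hs) ⟨hcl'.subset (by exact_mod_cast ht), htc⟩
  have hWne : W.Nonempty := by
    by_contra h
    rw [Finset.not_nonempty_iff_eq_empty] at h
    exact hc.1 (h ▸ listColorableOn_empty)
  have hcard : W.card = H := by
    by_contra hne
    obtain ⟨v, hv⟩ := hWne
    have h1 := hdeg v hv
    have h2 := degreeIn_lt_card (G := G) hv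
    exact hnoclique W subset_rfl (by omega)
      (isClique_of_card_le_degreeIn fun v hv => by have := hdeg v hv; omega)
  by_cases hcommon : ∃ x ∈ W, ∃ y ∈ W, x ≠ y ∧ ¬ G.Adj x y ∧ ¬ Disjoint (L x) (L y)
  · obtain ⟨x, hx, y, hy, hxy, hadj, hdis⟩ := hcommon
    obtain ⟨z, hzx, hzy⟩ := Finset.not_disjoint_iff.1 hdis
    have hcard2 := card_sdiff_pair hx hy hxy
    have hlist : ∀ v ∈ W, H - 3 ≤ ((L v).erase z).card := fun v hv => by
      have := Finset.pred_card_le_card_erase (s := L v) (a := z)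
      have := hLA v hv
      omega
    -- `x` is adjacent to all of `W` except `y`
    have hxadj : ∀ a ∈ W \ {x, y}, G.Adj x a := by
      intro a ha
      simp only [Finset.mem_sdiff, Finset.mem_insert, Finset.mem_singleton, not_or] at ha
      by_contra hn
      have h1 := card_nonadj_add_degreeIn (G := G) hx
      have h2 := hdeg x hx
      have h3 : 1 < ((W.erase x).filter fun a => ¬ G.Adj x a).card :=
        Finset.one_lt_card.2 ⟨y, by simp [hy, hxy.symm, hadj], a, by simp [ha, hn],
          fun h => ha.2.2 h.symm⟩
      omega
    have hex : ∃ p ∈ W \ {x, y}, ∃ q ∈ W \ {x, y}, p ≠ q ∧ ¬ G.Adj p q := by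
      by_contra! hall
      refine hnoclique (W.erase y) (Finset.erase_subset _ _)
        (by rw [Finset.card_erase_of_mem hy]; omega) ?_
      have hmem : ∀ a, a ∈ W.erase y → a ≠ x → a ∈ W \ {x, y} := fun a ha hax => by
        simp at ha ⊢; tauto
      intro p hp q hq hpq
      by_cases hpx : p = x
      · subst hpx
        exact hxadj q (hmem q hq hpq.symm)
      · by_cases hqx : q = x
        · subst hqx
          exact (hxadj p (hmem p hp hpx)).symm
        · exact hall p (hmem p hp hpx) q (hmem q hq hqx) hpq
    obtain ⟨p, hp, q, hq, hpq, hpqadj⟩ := hex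
    refine hc.1 (ListColorableOn.of_common_color hadj hzx hzy ?_)
    have hcard3 := Finset.card_erase_add_one hp
    have h1 : ListColorableOn G (fun v => (L v).erase z) ((W \ {x, y}).erase p) := by
      refine ListColorableOn.of_card_le listColorableOn_empty (Finset.empty_subset _) fun v hv => ?_
      have hv' : v ∈ W := by
        simp only [Finset.mem_sdiff, Finset.mem_erase] at hv; exact hv.1.2.1
      have := hlist v hv'
      omega
    -- `p` comes last: as it is not adjacent to `q`, it has at most `H - 4` colored neighbours and
    -- still `H - 3` colors.
    rw [← Finset.insert_erase hp]
    refine h1.insert ?_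
    have h2 : degreeIn G ((W \ {x, y}).erase p) p < ((W \ {x, y}).erase p).card :=
      Finset.card_lt_card ⟨Finset.filter_subset _ _, fun h =>
        hpqadj (Finset.mem_filter.1 (h (Finset.mem_erase.2 ⟨hpq.symm, hq⟩))).2⟩
    have := hlist p (Finset.mem_sdiff.1 hp).1
    omega
  · push Not at hcommon
    refine hc.1 (listColorableOn_of_disjoint (A := W) (H := H) (by omega) (by omega) hLA
      (fun v hv h => (h hv).elim) hcommon hcl ?_)
    intro h
    have := h.card_eq
    omega

theorem ListCritical.adj_of_notMem (hc : ListCritical G L W) (hcard : W.card = H + 1)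
    (hLB : ∀ v ∈ W, v ∉ A → (L v).card = H) {v w : V} (hv : v ∈ W) (hvA : v ∉ A) (hw : w ∈ W)
    (hvw : v ≠ w) : G.Adj v w := by
  refine adj_of_card_le_degreeIn_add_one hv ?_ hw hvw
  have := hc.card_le_degreeIn hv
  have := hLB v hv hvA
  omega

/-- Vertices off `A` are adjacent to everything, so nonadjacent pairs lie in `A`. If such a pair
shares a color, use it on both; when `|A| < H`, at most `H - 3` vertices of `A` remain, with as many
colors each, and the vertices off `A` can follow greedily. If no pair shares a color, Hall's theorem
applies. -/
theorem not_listCritical_of_card_lt (hH : 6 ≤ H) (hc : ListCritical G L W) (hA : A ⊆ W)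
    (hcard : W.card = H + 1)
    (hLA : ∀ v ∈ A, (L v).card = H - 2) (hLB : ∀ v ∈ W, v ∉ A → (L v).card = H)
    (hcl : ∀ s ⊆ A, ¬ G.IsNClique (H - 1) s) (hW : ¬ G.IsNClique (H + 1) W) : H ≤ A.card := by
  by_contra! hAH
  by_cases hcommon : ∃ x ∈ W, ∃ y ∈ W, x ≠ y ∧ ¬ G.Adj x y ∧ ¬ Disjoint (L x) (L y)
  · obtain ⟨x, hx, y, hy, hxy, hadj, hdis⟩ := hcommon
    obtain ⟨z, hzx, hzy⟩ := Finset.not_disjoint_iff.1 hdis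
    have hcard2 := card_sdiff_pair hx hy hxy
    have hxA : x ∈ A := by
      by_contra h
      exact hadj (hc.adj_of_notMem hcard hLB hx h hy hxy)
    have hyA : y ∈ A := by
      by_contra h
      exact hadj (hc.adj_of_notMem hcard hLB hy h hx hxy.symm).symm
    have hcard3 := card_sdiff_pair hxA hyA hxy
    have herase : ∀ v, (L v).card - 1 ≤ ((L v).erase z).card := fun v =>
      Finset.pred_card_le_card_erase
    refine hc.1 (ListColorableOn.of_common_color hadj hzx hzy ?_)
    have h1 : ListColorableOn G (fun v => (L v).erase z) (A \ {x, y}) := by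
      refine ListColorableOn.of_card_le listColorableOn_empty (Finset.empty_subset _) fun v hv => ?_
      have := hLA v (by simp at hv; exact hv.1)
      have := herase v
      omega
    refine h1.of_card_le (Finset.sdiff_subset_sdiff hA subset_rfl) fun v hv => ?_
    simp only [Finset.mem_sdiff, Finset.mem_insert, Finset.mem_singleton] at hv
    have := hLB v hv.1.1 (by tauto)
    have := herase v
    omega
  · push Not at hcommon
    exact hc.1 (listColorableOn_of_disjoint (by omega) (by omega) hLA hLB hcommon hcl hW)

/-- At most four vertices (`P`) have degree above their list size; the others (`Z`) number at least
`H - 3 ≥ 7`. Every vertex has at most two non-neighbours, so if `A` had `H` vertices, `Z` would be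
large enough to contain an induced diamond. -/
theorem not_listCritical_of_sum_le (hH : 10 ≤ H) (hc : ListCritical G L W) (hA : A ⊆ W)
    (hcard : W.card = H + 1)
    (hLA : ∀ v ∈ A, (L v).card = H - 2) (hLB : ∀ v ∈ W, v ∉ A → (L v).card = H)
    (hsum : ∑ v ∈ W, degreeIn G W v ≤ ∑ v ∈ W, (L v).card + 4) : A.card < H := by
  by_contra! hAH
  have hdeg : ∀ v ∈ W, (L v).card ≤ degreeIn G W v := fun v hv => hc.card_le_degreeIn hv
  set P := W.filter fun v => (L v).card < degreeIn G W v with hP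
  set Z := W.filter fun v => ¬ (L v).card < degreeIn G W v with hZ
  have hPcard : P.card ≤ 4 := by
    have h1 : ∑ v ∈ W, ((L v).card + if (L v).card < degreeIn G W v then 1 else 0) ≤
        ∑ v ∈ W, degreeIn G W v := Finset.sum_le_sum fun v hv => by
      have := hdeg v hv
      split_ifs <;> omega
    have h2 : P.card = ∑ v ∈ W, if (L v).card < degreeIn G W v then 1 else 0 := by
      rw [hP, Finset.card_filter]
    rw [Finset.sum_add_distrib, ← h2] at h1
    omega
  have hPZ : P.card + Z.card = W.card := Finset.card_filter_add_card_filter_not _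
  -- the non-neighbours of a vertex
  let N : V → Finset V := fun v => (W.erase v).filter fun a => ¬ G.Adj v a
  have hN : ∀ v ∈ W, (N v).card + degreeIn G W v = H := fun v hv => by
    have := card_nonadj_add_degreeIn (G := G) hv
    have e : (N v).card = ((W.erase v).filter fun a => ¬ G.Adj v a).card := rfl
    omega
  have hmemN : ∀ {v a}, a ∈ N v ↔ a ∈ W ∧ a ≠ v ∧ ¬ G.Adj v a := by
    intro v a
    simp only [N, Finset.mem_filter, Finset.mem_erase]
    tauto
  have hNsymm : ∀ {v a}, v ∈ W → a ∈ N v → v ∈ N a := by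
    intro v a hv ha
    rw [hmemN] at ha ⊢
    exact ⟨hv, ha.2.1.symm, fun h => ha.2.2 h.symm⟩
  have hL : ∀ v ∈ W, H - 2 ≤ (L v).card := fun v hv => by
    by_cases h : v ∈ A
    · exact (hLA v h).ge
    · have := hLB v hv h; omega
  have hN2 : ∀ v ∈ W, (N v).card ≤ 2 := fun v hv => by
    have := hN v hv
    have := hdeg v hv
    have := hL v hv
    omega
  have hNP : ∀ v ∈ P, (N v).card ≤ 1 := fun v hv => by
    have hv' := Finset.mem_filter.1 hv
    have := hN v hv'.1
    have := hL v hv'.1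
    omega
  have hZW : ∀ {v}, v ∈ Z → v ∈ W ∧ degreeIn G W v ≤ (L v).card := fun hv => by
    have := Finset.mem_filter.1 hv
    exact ⟨this.1, not_lt.1 this.2⟩
  -- two nonadjacent vertices in `Z`
  obtain ⟨x, hxA, hxP⟩ : ∃ x ∈ A \ P, x ∉ P.biUnion N := by
    apply Finset.exists_mem_notMem_of_card_lt_card
    have h1 : (P.biUnion N).card ≤ P.card * 1 := Finset.card_biUnion_le_card_mul _ _ _ hNP
    have h2 := Finset.le_card_sdiff P A
    omega
  rw [Finset.mem_sdiff] at hxA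
  have hxW := hA hxA.1
  have hxZ : x ∈ Z := Finset.mem_filter.2 ⟨hxW, fun h => hxA.2 (Finset.mem_filter.2 ⟨hxW, h⟩)⟩
  obtain ⟨y, hy⟩ : (N x).Nonempty := by
    rw [← Finset.card_pos]
    have := hN x hxW
    have := (hZW hxZ).2
    have := hLA x hxA.1
    omega
  have hy' := hmemN.1 hy
  have hyZ : y ∈ Z := Finset.mem_filter.2 ⟨hy'.1, fun h => hxP (Finset.mem_biUnion.2
    ⟨y, Finset.mem_filter.2 ⟨hy'.1, h⟩, hNsymm hxW hy⟩)⟩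
  have hadjN : ∀ {v a}, a ∈ W → a ≠ v → a ∉ N v → G.Adj v a := by
    intro v a ha hav h
    by_contra hn
    exact h (hmemN.2 ⟨ha, hav, hn⟩)
  -- Two common neighbours in `Z` of a nonadjacent pair in `Z` are nonadjacent, as they would
  -- otherwise form an induced diamond with the pair.
  have hdia : ∀ {p q w u}, p ∈ Z → w ∈ Z → u ∈ Z → q ∈ N p → q ∈ Z → w ≠ p → w ≠ q →
      u ≠ p → u ≠ q → w ∉ N p → w ∉ N q → u ∉ N p → u ∉ N q → w ≠ u → w ∈ N u := by
    intro p q w u hp hw hu hqp hq hwp hwq hup huq h1 h2 h3 h4 hwu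
    by_contra hn
    have hpq := hmemN.1 hqp
    refine hpq.2.2 (hc.adj_of_diamond (hZW hw).1 (hZW hu).1 (hZW hp).1 (hZW hq).1 (hZW hw).2
      (hZW hu).2 (hZW hp).2 (hZW hq).2 (hadjN (hZW hw).1 hwu hn).symm
      (hadjN (hZW hw).1 hwp h1).symm (hadjN (hZW hw).1 hwq h2).symm
      (hadjN (hZW hu).1 hup h3).symm (hadjN (hZW hu).1 huq h4).symm hpq.2.1.symm)
  set R := Z \ (N x ∪ N y) with hR
  have hRcard : 3 ≤ R.card := by
    have h1 := Finset.le_card_sdiff (N x ∪ N y) Z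
    have h2 := Finset.card_union_le (N x) (N y)
    have h3 := hN2 x hxW
    have h4 := hN2 y hy'.1
    rw [← hR] at h1
    omega
  have hxyN := hNsymm hxW hy
  have hRmem : ∀ {a}, a ∈ R → a ∈ Z ∧ a ≠ x ∧ a ≠ y ∧ a ∉ N x ∧ a ∉ N y := by
    intro a ha
    simp only [hR, Finset.mem_sdiff, Finset.mem_union, not_or] at ha
    exact ⟨ha.1, fun h => ha.2.2 (h ▸ hxyN), fun h => ha.2.1 (h ▸ hy), ha.2.1, ha.2.2⟩
  obtain ⟨u, hu, v, hv, w, hw, huv, huw, hvw⟩ := Finset.two_lt_card.1 hRcard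
  have hRN : ∀ {a b}, a ∈ R → b ∈ R → a ≠ b → a ∈ N b := by
    intro a b ha hb hab
    obtain ⟨h1, h2, h3, h4, h5⟩ := hRmem ha
    obtain ⟨g1, g2, g3, g4, g5⟩ := hRmem hb
    exact hdia hxZ h1 g1 hy hyZ h2 h3 g2 g3 h4 h5 g4 g5 hab
  have hNu : N u = {v, w} := (Finset.eq_of_subset_of_card_le (by
    intro a ha
    simp only [Finset.mem_insert, Finset.mem_singleton] at ha
    rcases ha with rfl | rfl
    · exact hRN hv hu huv.symm
    · exact hRN hw hu huw.symm) (by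
    rw [Finset.card_pair hvw]; exact hN2 u (hZW (hRmem hu).1).1)).symm
  have hNv : N v = {u, w} := (Finset.eq_of_subset_of_card_le (by
    intro a ha
    simp only [Finset.mem_insert, Finset.mem_singleton] at ha
    rcases ha with rfl | rfl
    · exact hRN hu hv huv
    · exact hRN hw hv hvw.symm) (by
    rw [Finset.card_pair huw]; exact hN2 v (hZW (hRmem hv).1).1)).symm
  -- The vertices `u`, `v`, `w` use up each other's non-neighbours, so `z` and `x` are both adjacent
  -- to the nonadjacent `u` and `v`. The six excluded vertices cannot exhaust the at least seven of
  -- `Z`, and `z` is chosen adjacent to `x`.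
  obtain ⟨z, hz, hz'⟩ : ∃ z ∈ Z, z ∉ ({u, v, w} ∪ insert x (N x) : Finset V) := by
    apply Finset.exists_mem_notMem_of_card_lt_card
    have h1 := Finset.card_union_le {u, v, w} (insert x (N x))
    have h2 := Finset.card_le_three (a := u) (b := v) (c := w)
    have h3 := Finset.card_insert_le x (N x)
    have h4 := hN2 x hxW
    omega
  simp only [Finset.mem_union, Finset.mem_insert, Finset.mem_singleton, not_or] at hz'
  obtain ⟨⟨hzu, hzv, hzw⟩, hzx, hzN⟩ := hz'
  obtain ⟨h1, h2, h3, h4, h5⟩ := hRmem hu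
  obtain ⟨g1, g2, g3, g4, g5⟩ := hRmem hv
  have hxw := (hRmem hw).2.1
  refine hzN (hdia (p := u) (q := v) h1 hz hxZ (hRN hv hu huv.symm) g1 hzu hzv h2.symm g2.symm
    ?_ ?_ ?_ ?_ hzx)
  · rw [hNu]; simp [hzv, hzw]
  · rw [hNv]; simp [hzu, hzw]
  · rw [hNu]; simp [g2.symm, hxw.symm]
  · rw [hNv]; simp [h2.symm, hxw.symm]

end HeawoodLists

/-! ### Arithmetic of the Heawood number. -/

section HeawoodNumber

/-- The floor gives `√(24ε + 1) < 2H - 5`, which is then squared. This is the inequality that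
excludes `K_{H+1}`. -/
theorem heawood_mul_lt (ε : ℕ) : 6 * ε + 5 * heawood ε < heawood ε ^ 2 + 6 := by
  set s := Real.sqrt (24 * (ε : ℝ) + 1) with hs
  have h0 : 0 ≤ s := Real.sqrt_nonneg _
  have hsq : s ^ 2 = 24 * (ε : ℝ) + 1 := Real.sq_sqrt (by positivity)
  have h1 : (7 + s) / 2 < (heawood ε : ℝ) + 1 := Nat.lt_floor_add_one _
  have h2 : s < 2 * (heawood ε : ℝ) - 5 := by linarith
  have h3 : (6 * ε + 5 * heawood ε : ℝ) < (heawood ε : ℝ) ^ 2 + 6 := by nlinarith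
  exact_mod_cast h3

theorem six_le_heawood {ε : ℕ} (hε : 1 ≤ ε) : 6 ≤ heawood ε := by
  apply Nat.le_floor
  have h1 : (5 : ℝ) ≤ Real.sqrt (24 * (ε : ℝ) + 1) := by
    apply Real.le_sqrt_of_sq_le
    have : (1 : ℝ) ≤ ε := by exact_mod_cast hε
    linarith
  push_cast
  linarith

/-- Both sides of `heawood_mul_lt` have the same parity, so the gap is at least two. -/
theorem heawood_mul_le (ε : ℕ) : 6 * ε + 5 * heawood ε ≤ heawood ε ^ 2 + 4 := by
  have h1 := heawood_mul_lt ε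
  have h2 : Even (heawood ε ^ 2 + 5 * heawood ε) := by
    have : heawood ε ^ 2 + 5 * heawood ε = heawood ε * (heawood ε + 1) + 2 * (2 * heawood ε) := by
      ring
    rw [this]
    exact (Nat.even_mul_succ_self _).add (even_two_mul _)
  obtain ⟨k, hk⟩ := h2
  omega

/-- For `H = 6, 7, 8, 9` the value of `H² - 5H` is 6, 14, 24, 36, while `ε` is at most 1, 3, 4, 6.
Only `ε = 3` with `H = 7` fails, since `18 > 14`. -/
theorem heawood_mul_le_of_lt {ε : ℕ} (hε : 1 ≤ ε) (hε3 : ε ≠ 3) (hH : heawood ε < 10) :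
    6 * ε + 5 * heawood ε ≤ heawood ε ^ 2 := by
  have h1 := heawood_mul_lt ε
  have h2 := six_le_heawood hε
  generalize heawood ε = H at *
  interval_cases H <;> omega

end HeawoodNumber

/-! ### Faces of a graph in the 1-skeleton, and parity of their corners. -/

namespace ClosedSurface

open scoped Classical

variable {X : Type v} [Fintype X] (S : ClosedSurface X) (Γ : SimpleGraph X)

/-- The triangles of the surface. -/
abbrev Triangle : Type v := {t : Finset X // t ∈ S.triangles}

/-- Two triangles are neighbours when they share an edge that is not an edge of `Γ`. -/
def dualGraph : SimpleGraph S.Triangle where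
  Adj t t' := t ≠ t' ∧
    ∃ x y : X, x ≠ y ∧ x ∈ t.1 ∧ y ∈ t.1 ∧ x ∈ t'.1 ∧ y ∈ t'.1 ∧ ¬ Γ.Adj x y
  symm := ⟨fun _ _ ⟨hne, x, y, hxy, h1, h2, h3, h4, h5⟩ =>
    ⟨hne.symm, x, y, hxy, h3, h4, h1, h2, h5⟩⟩
  loopless := ⟨fun _ h => h.1 rfl⟩

/-- The faces of the graph `Γ` drawn in the 1-skeleton. -/
abbrev GraphFace : Type v := (S.dualGraph Γ).ConnectedComponent

/-- The face that contains the triangle `t`. -/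
abbrev faceOf (t : S.Triangle) : S.GraphFace Γ := (S.dualGraph Γ).connectedComponentMk t

noncomputable instance : Fintype (S.GraphFace Γ) :=
  haveI : Finite (S.GraphFace Γ) := Quot.finite _
  Fintype.ofFinite _

variable {S Γ}

theorem faceOf_eq {x y : X} {t t' : S.Triangle} (hxy : x ≠ y) (hΓ : ¬ Γ.Adj x y) (hx : x ∈ t.1)
    (hy : y ∈ t.1) (hx' : x ∈ t'.1) (hy' : y ∈ t'.1) : S.faceOf Γ t = S.faceOf Γ t' := by
  by_cases h : t = t'
  · rw [h]
  · exact SimpleGraph.ConnectedComponent.sound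
      (SimpleGraph.Adj.reachable ⟨h, x, y, hxy, hx, hy, hx', hy', hΓ⟩)

theorem adj_of_mem (t : S.Triangle) {x y : X} (hx : x ∈ t.1) (hy : y ∈ t.1) (hxy : x ≠ y) :
    S.skeleton.Adj x y := ⟨hxy, t.1, t.2, hx, hy⟩

theorem card_triangles_of_adj {x y : X} (h : S.skeleton.Adj x y) :
    (Finset.univ.filter fun t : S.Triangle => x ∈ t.1 ∧ y ∈ t.1).card = 2 := by
  rw [← S.edge_two_triangles x y h, ← Set.ncard_coe_finset,
    ← Set.ncard_image_of_injective _ Subtype.val_injective]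
  congr 1
  ext t
  simp only [Finset.coe_filter, Finset.mem_univ, true_and, Set.mem_image, Set.mem_ofPred_eq]
  constructor
  · rintro ⟨s, hs, rfl⟩
    exact ⟨s.2, hs⟩
  · rintro ⟨ht, hs⟩
    exact ⟨⟨t, ht⟩, hs, rfl⟩

theorem exists_triangle_of_adj {x y : X} (h : S.skeleton.Adj x y) :
    ∃ t : S.Triangle, x ∈ t.1 ∧ y ∈ t.1 := by
  obtain ⟨_, t, ht, hx, hy⟩ := h
  exact ⟨⟨t, ht⟩, hx, hy⟩

theorem card_erase_triangle (t : S.Triangle) {x : X} (hx : x ∈ t.1) : (t.1.erase x).card = 2 := by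
  rw [Finset.card_erase_of_mem hx, S.card_triangle t.1 t.2]

/-- A property of the triangles at `x` that passes from a triangle to its two neighbours around `x`
holds for all of them if it holds for one. -/
theorem forall_triangle_at {x : X} {P : S.Triangle → Prop}
    (hP : ∀ y, y ≠ x → ∀ t t' : S.Triangle, x ∈ t.1 → y ∈ t.1 → x ∈ t'.1 → y ∈ t'.1 → P t → P t')
    {t₀ : S.Triangle} (hx₀ : x ∈ t₀.1) (h₀ : P t₀) (t : S.Triangle) (hx : x ∈ t.1) : P t := by
  have hex : ∀ s : S.Triangle, x ∈ s.1 → ∃ y, y ≠ x ∧ y ∈ s.1 := fun s hs => by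
    obtain ⟨y, hy⟩ := Finset.card_pos.1 (by rw [card_erase_triangle s hs]; norm_num :
      0 < (s.1.erase x).card)
    exact ⟨y, (Finset.mem_erase.1 hy).1, (Finset.mem_erase.1 hy).2⟩
  obtain ⟨y, hyx, hy⟩ := hex t₀ hx₀
  obtain ⟨z, hzx, hz⟩ := hex t hx
  obtain ⟨p⟩ := (S.link_connected x).preconnected ⟨y, adj_of_mem t₀ hx₀ hy hyx.symm⟩
    ⟨z, adj_of_mem t hx hz hzx.symm⟩
  have key : ∀ a b : {y : X // S.skeleton.Adj x y}, (S.link x).Walk a b →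
      (∀ s : S.Triangle, x ∈ s.1 → a.1 ∈ s.1 → P s) → ∀ s : S.Triangle, x ∈ s.1 → b.1 ∈ s.1 → P s := by
    intro a b q
    induction q with
    | nil => exact fun h => h
    | cons hab _ ih =>
      rename_i a b c _
      intro h
      refine ih fun s hs hbs => ?_
      obtain ⟨_, r, hr, hxr, har, hbr⟩ := hab
      exact hP b.1 b.2.1.symm ⟨r, hr⟩ s hxr hbr hs hbs (h ⟨r, hr⟩ hxr har)
  exact key _ _ p (fun s hs hys => hP y hyx t₀ s hx₀ hy hs hys h₀) t hx hz

theorem forall_triangle {P : S.Triangle → Prop}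
    (hP : ∀ x y, y ≠ x → ∀ t t' : S.Triangle, x ∈ t.1 → y ∈ t.1 → x ∈ t'.1 → y ∈ t'.1 → P t → P t')
    {t₀ : S.Triangle} (h₀ : P t₀) (t : S.Triangle) : P t := by
  have hex : ∀ s : S.Triangle, ∃ y, y ∈ s.1 := fun s =>
    Finset.card_pos.1 (by rw [S.card_triangle s.1 s.2]; norm_num)
  obtain ⟨y, hy⟩ := hex t₀
  obtain ⟨z, hz⟩ := hex t
  obtain ⟨p⟩ := S.connected.preconnected y z
  have key : ∀ a b : X, S.skeleton.Walk a b →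
      (∀ s : S.Triangle, a ∈ s.1 → P s) → ∀ s : S.Triangle, b ∈ s.1 → P s := by
    intro a b q
    induction q with
    | nil => exact fun h => h
    | cons hab _ ih =>
      intro h
      obtain ⟨r, har, hbr⟩ := exists_triangle_of_adj hab
      exact ih (forall_triangle_at (hP _) hbr (h r har))
  exact key _ _ p (forall_triangle_at (hP y) hy h₀) t hz

variable (S) in
/-- The pairs of an edge `xy` with `Y y` and a triangle with `P` containing it. -/
noncomputable def corners (P : S.Triangle → Prop) (Y : X → Prop) (x : X) :
    Finset (X × S.Triangle) :=
  Finset.univ.filter fun p => p.1 ≠ x ∧ Y p.1 ∧ x ∈ p.2.1 ∧ p.1 ∈ p.2.1 ∧ P p.2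

theorem mem_corners {P : S.Triangle → Prop} {Y : X → Prop} {x : X} {p : X × S.Triangle} :
    p ∈ S.corners P Y x ↔ p.1 ≠ x ∧ Y p.1 ∧ x ∈ p.2.1 ∧ p.1 ∈ p.2.1 ∧ P p.2 := by
  simp [corners]

theorem card_corners_eq_sum_vertices (P : S.Triangle → Prop) (Y : X → Prop) (x : X) :
    (S.corners P Y x).card = ∑ y : X, if y ≠ x ∧ Y y then
      (Finset.univ.filter fun t : S.Triangle => x ∈ t.1 ∧ y ∈ t.1 ∧ P t).card else 0 := by
  rw [corners, Finset.card_filter, Fintype.sum_prod_type]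
  refine Finset.sum_congr rfl fun y _ => ?_
  split_ifs with h
  · rw [Finset.card_filter]
    refine Finset.sum_congr rfl fun t _ => if_congr ?_ rfl rfl
    simp [h.1, h.2]
  · refine Finset.sum_eq_zero fun t _ => if_neg ?_
    tauto

theorem card_corners_eq_sum_triangles (P : S.Triangle → Prop) (x : X) :
    (S.corners P (fun _ => True) x).card = ∑ t : S.Triangle, if x ∈ t.1 ∧ P t then 2 else 0 := by
  rw [corners, Finset.card_filter, Fintype.sum_prod_type_right]
  refine Finset.sum_congr rfl fun t _ => ?_
  split_ifs with h
  · have e : t.1.erase x =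
        Finset.univ.filter fun y => y ≠ x ∧ True ∧ x ∈ t.1 ∧ y ∈ t.1 ∧ P t := by
      ext y
      simp [h.1, h.2]
    rw [← card_erase_triangle t h.1, e, Finset.card_filter]
    exact Finset.sum_congr rfl fun y _ => by congr
  · refine Finset.sum_eq_zero fun y _ => if_neg ?_
    tauto

theorem card_corners_split (P : S.Triangle → Prop) (Y Y' : X → Prop) (x : X) :
    (S.corners P (fun y => Y' y ∧ Y y) x).card + (S.corners P (fun y => Y' y ∧ ¬ Y y) x).card =
      (S.corners P Y' x).card := by
  rw [← Finset.card_union_of_disjoint]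
  · congr 1
    ext p
    simp only [Finset.mem_union, mem_corners]
    tauto
  · rw [Finset.disjoint_left]
    intro p
    simp only [mem_corners]
    tauto

theorem card_corners_split' (P Q : S.Triangle → Prop) (Y : X → Prop) (x : X) :
    (S.corners (fun t => P t ∧ Q t) Y x).card + (S.corners (fun t => P t ∧ ¬ Q t) Y x).card =
      (S.corners P Y x).card := by
  rw [← Finset.card_union_of_disjoint]
  · congr 1
    ext p
    simp only [Finset.mem_union, mem_corners]
    tauto
  · rw [Finset.disjoint_left]
    intro p
    simp only [mem_corners]
    tauto

/-- If `P` is a property of triangles that does not change when crossing the edges `xy` with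
`¬ Y y`, then the number of its borders at `x` is even. -/
theorem even_card_corners {P : S.Triangle → Prop} {Y : X → Prop} {x : X}
    (hP : ∀ y, y ≠ x → ¬ Y y → ∀ t t' : S.Triangle, x ∈ t.1 → y ∈ t.1 → x ∈ t'.1 → y ∈ t'.1 →
      P t → P t') : Even (S.corners P Y x).card := by
  -- The corners of all triangles with `P` are two per triangle. On an edge outside `Y` both
  -- triangles have `P` or neither has. The rest is therefore even.
  have h1 := card_corners_split P Y (fun _ => True) x
  simp only [true_and] at h1
  have h2 : Even (S.corners P (fun _ => True) x).card := by
    rw [card_corners_eq_sum_triangles]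
    refine Finset.even_sum _ fun t _ => ?_
    split_ifs <;> simp
  have h3 : Even (S.corners P (fun y => ¬ Y y) x).card := by
    rw [card_corners_eq_sum_vertices]
    refine Finset.even_sum _ fun y _ => ?_
    split_ifs with h
    · by_cases hex : ∃ t : S.Triangle, x ∈ t.1 ∧ y ∈ t.1 ∧ P t
      · obtain ⟨t, hx, hy, ht⟩ := hex
        have h4 := card_triangles_of_adj (adj_of_mem t hx hy h.1.symm)
        have h5 : (Finset.univ.filter fun t : S.Triangle => x ∈ t.1 ∧ y ∈ t.1 ∧ P t) =
            Finset.univ.filter fun t : S.Triangle => x ∈ t.1 ∧ y ∈ t.1 := by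
          ext s
          simp only [Finset.mem_filter, Finset.mem_univ, true_and]
          exact ⟨fun h => ⟨h.1, h.2.1⟩, fun hs =>
            ⟨hs.1, hs.2, hP y h.1 h.2 t s hx hy hs.1 hs.2 ht⟩⟩
        rw [h5, h4]
        exact even_two
      · rw [Finset.filter_eq_empty_iff.2]
        · simp
        · intro t _ ht
          exact hex ⟨t, ht⟩
    · simp
  rw [← h1] at h2
  exact (Nat.even_add.1 h2).2 h3

theorem forall_of_corners_eq_empty {P : S.Triangle → Prop} {Y : X → Prop} {x : X}
    (hP : ∀ y, y ≠ x → ¬ Y y → ∀ t t' : S.Triangle, x ∈ t.1 → y ∈ t.1 → x ∈ t'.1 → y ∈ t'.1 →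
      P t → P t') (hc : S.corners P Y x = ∅) {t₀ : S.Triangle} (hx₀ : x ∈ t₀.1) (h₀ : P t₀)
    (t : S.Triangle) (hx : x ∈ t.1) : P t := by
  refine forall_triangle_at (fun y hy s s' h1 h2 h3 h4 h5 => ?_) hx₀ h₀ t hx
  by_cases hY : Y y
  · have : (y, s) ∈ S.corners P Y x := mem_corners.2 ⟨hy, hY, h1, h2, h5⟩
    rw [hc] at this
    simp at this
  · exact hP y hy hY s s' h1 h2 h3 h4 h5

variable (S Γ) in
/-- The corners of the face `f` at `x`, each given by its two sides. -/
noncomputable def faceCorners (f : S.GraphFace Γ) (x : X) : Finset (X × S.Triangle) :=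
  S.corners (fun t => S.faceOf Γ t = f) (Γ.Adj x) x

theorem mem_faceCorners {f : S.GraphFace Γ} {x y : X} {t : S.Triangle} :
    (y, t) ∈ S.faceCorners Γ f x ↔ Γ.Adj x y ∧ x ∈ t.1 ∧ y ∈ t.1 ∧ S.faceOf Γ t = f := by
  rw [faceCorners, mem_corners]
  exact ⟨fun h => h.2, fun h => ⟨h.1.ne', h⟩⟩

theorem faceOf_closed (f : S.GraphFace Γ) (x : X) : ∀ y, y ≠ x → ¬ Γ.Adj x y →
    ∀ t t' : S.Triangle, x ∈ t.1 → y ∈ t.1 → x ∈ t'.1 → y ∈ t'.1 →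
      S.faceOf Γ t = f → S.faceOf Γ t' = f :=
  fun _ hy hΓ _ _ h1 h2 h3 h4 h5 => (faceOf_eq hy.symm hΓ h1 h2 h3 h4).symm.trans h5

theorem even_card_faceCorners (f : S.GraphFace Γ) (x : X) : Even (S.faceCorners Γ f x).card :=
  even_card_corners (faceOf_closed f x)

/-- If no edge at `x` bordered `f`, the face would spread around the whole link of `x`, and so would
border the edge `xy` after all. -/
theorem faceCorners_nonempty (hΓ : Γ ≤ S.skeleton) {f : S.GraphFace Γ} {x y : X}
    (hxy : Γ.Adj x y) {t : S.Triangle} (hx : x ∈ t.1) (ht : S.faceOf Γ t = f) :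
    (S.faceCorners Γ f x).Nonempty := by
  rw [Finset.nonempty_iff_ne_empty]
  intro h
  obtain ⟨s, hxs, hys⟩ := exists_triangle_of_adj (hΓ hxy)
  have := forall_of_corners_eq_empty (faceOf_closed f x) h hx ht s hxs
  have h2 := mem_faceCorners.2 ⟨hxy, hxs, hys, this⟩
  rw [h] at h2
  simp at h2

theorem two_le_card_faceCorners {f : S.GraphFace Γ} {x : X}
    (h : (S.faceCorners Γ f x).Nonempty) : 2 ≤ (S.faceCorners Γ f x).card := by
  have h1 := Finset.card_pos.2 h
  obtain ⟨k, hk⟩ := even_card_faceCorners f x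
  omega

theorem faceCorners_nonempty_symm {f : S.GraphFace Γ} {x y : X} {t : S.Triangle}
    (h : (y, t) ∈ S.faceCorners Γ f x) : (x, t) ∈ S.faceCorners Γ f y := by
  rw [mem_faceCorners] at h ⊢
  exact ⟨h.1.symm, h.2.2.1, h.2.1, h.2.2.2⟩

variable (S Γ) in
/-- The vertices on the face `f` that have an edge on it. -/
noncomputable def faceVertices (f : S.GraphFace Γ) : Finset X :=
  Finset.univ.filter fun x => (S.faceCorners Γ f x).Nonempty

theorem mem_faceVertices {f : S.GraphFace Γ} {x : X} :
    x ∈ S.faceVertices Γ f ↔ (S.faceCorners Γ f x).Nonempty := by simp [faceVertices]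

/-- A face of a graph with at least three non-isolated vertices has at least three vertices. -/
theorem three_le_card_faceVertices (hΓ : Γ ≤ S.skeleton)
    (h3 : ∃ s : Finset X, 3 ≤ s.card ∧ ∀ x ∈ s, ∃ y, Γ.Adj x y) (f : S.GraphFace Γ) :
    3 ≤ (S.faceVertices Γ f).card := by
  by_contra! hlt
  obtain ⟨t₀, ht₀⟩ := Quot.exists_rep f
  -- With at most two vertices the face is the whole surface: all its sides at `x` lie along the one
  -- edge `xy`, and evenness puts both sides of that edge in `f`.
  have hall : ∀ t, S.faceOf Γ t = f := by
    refine forall_triangle (fun x y hyx t t' hx hy hx' hy' ht => ?_) ht₀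
    by_cases hadj : Γ.Adj x y
    · by_contra ht'
      have hc : (y, t) ∈ S.faceCorners Γ f x := mem_faceCorners.2 ⟨hadj, hx, hy, ht⟩
      have hxV : x ∈ S.faceVertices Γ f := mem_faceVertices.2 ⟨_, hc⟩
      have hyV : y ∈ S.faceVertices Γ f := mem_faceVertices.2 ⟨_, faceCorners_nonempty_symm hc⟩
      have hV : ({x, y} : Finset X) = S.faceVertices Γ f := by
        refine Finset.eq_of_subset_of_card_le ?_ ?_
        · intro a ha; simp at ha; rcases ha with rfl | rfl <;> assumption
        · rw [Finset.card_pair hyx.symm]; omega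
      have h2 := two_le_card_faceCorners ⟨_, hc⟩
      have htri := card_triangles_of_adj (hΓ hadj)
      have hsub : ∀ p ∈ S.faceCorners Γ f x, p.1 = y := by
        rintro ⟨z, s⟩ hp
        have hz : z ∈ S.faceVertices Γ f := mem_faceVertices.2 ⟨_, faceCorners_nonempty_symm hp⟩
        rw [← hV] at hz
        have := (mem_faceCorners.1 hp).1.ne'
        simp at hz
        tauto
      have h4 : (S.faceCorners Γ f x).image Prod.snd ⊆
          (Finset.univ.filter fun t : S.Triangle => x ∈ t.1 ∧ y ∈ t.1).erase t' := by
        intro s hs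
        obtain ⟨⟨z, s⟩, hp, rfl⟩ := Finset.mem_image.1 hs
        have hz := hsub _ hp
        simp only at hz
        subst hz
        have hp' := mem_faceCorners.1 hp
        simp only [Finset.mem_erase, Finset.mem_filter, Finset.mem_univ, true_and]
        exact ⟨fun h => ht' (h ▸ hp'.2.2.2), hp'.2.1, hp'.2.2.1⟩
      have h5 := Finset.card_le_card h4
      rw [Finset.card_erase_of_mem (by simp [hx', hy']), htri,
        Finset.card_image_of_injOn] at h5
      · omega
      · intro p hp q hq hpq
        exact Prod.ext ((hsub p hp).trans (hsub q hq).symm) hpq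
    · exact (faceOf_eq hyx.symm hadj hx hy hx' hy').symm.trans ht
  obtain ⟨s, hs, hsadj⟩ := h3
  have : s ⊆ S.faceVertices Γ f := fun x hx => by
    obtain ⟨y, hxy⟩ := hsadj x hx
    obtain ⟨t, htx, _⟩ := exists_triangle_of_adj (hΓ hxy)
    exact mem_faceVertices.2 (faceCorners_nonempty hΓ hxy htx (hall t))
  have := Finset.card_le_card this
  omega

/-- Every edge has two sides, and each side is counted from both of its ends. -/
theorem sum_card_faceCorners (hΓ : Γ ≤ S.skeleton) :
    ∑ f : S.GraphFace Γ, ∑ x : X, (S.faceCorners Γ f x).card = 4 * Γ.edgeSet.ncard := by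
  have h1 : ∀ x, ∑ f : S.GraphFace Γ, (S.faceCorners Γ f x).card = 2 * Γ.degree x := by
    intro x
    have : (S.corners (fun _ => True) (Γ.Adj x) x).card =
        ∑ f : S.GraphFace Γ, (S.faceCorners Γ f x).card := by
      rw [Finset.card_eq_sum_card_fiberwise (f := fun p => S.faceOf Γ p.2)
        (t := Finset.univ) (fun _ _ => Finset.mem_coe.2 (Finset.mem_univ _))]
      refine Finset.sum_congr rfl fun f _ => ?_
      congr 1
      ext p
      simp only [Finset.mem_filter, faceCorners, mem_corners]
      tauto
    rw [← this, card_corners_eq_sum_vertices, ← SimpleGraph.card_neighborFinset_eq_degree,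
      SimpleGraph.neighborFinset_eq_filter, Finset.card_filter, Finset.mul_sum]
    refine Finset.sum_congr rfl fun y _ => ?_
    by_cases h : Γ.Adj x y
    · simp only [h.ne', h, ne_eq, not_false_eq_true, and_self, and_true, if_true, mul_one]
      exact card_triangles_of_adj (hΓ h)
    · simp [h]
  rw [Finset.sum_comm, Finset.sum_congr rfl fun x _ => h1 x, ← Finset.mul_sum,
    SimpleGraph.sum_degrees_eq_twice_card_edges, ← SimpleGraph.coe_edgeFinset,
    Set.ncard_coe_finset]
  ring

end ClosedSurface

/-! ### Euler's inequality by cochains modulo 2, and edge bounds. -/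

namespace ClosedSurface

open scoped Classical

variable {X : Type v} [Fintype X] (S : ClosedSurface X) (Γ : SimpleGraph X)

/-- The edges of the triangulation that are not edges of `Γ`. -/
abbrev FreeEdge : Type v := {e : Sym2 X // e ∈ S.skeleton.edgeSet ∧ e ∉ Γ.edgeSet}

/-- The coboundary from 2-cochains to the edges that are not in `Γ`, modulo 2. -/
noncomputable def coboundary : (S.Triangle → ZMod 2) →ₗ[ZMod 2] (S.FreeEdge Γ → ZMod 2) where
  toFun g e := ∑ t : S.Triangle, if ∀ a ∈ e.1, a ∈ t.1 then g t else 0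
  map_add' g h := by
    ext e
    simp only [Pi.add_apply, ← Finset.sum_add_distrib]
    exact Finset.sum_congr rfl fun t _ => by split_ifs <;> simp
  map_smul' c g := by
    ext e
    simp only [Pi.smul_apply, smul_eq_mul, RingHom.id_apply, Finset.mul_sum, mul_ite, mul_zero]

/-- The sum of the values on the edges at each vertex outside `U`, modulo 2. -/
noncomputable def starSum (U : Finset X) :
    (S.FreeEdge Γ → ZMod 2) →ₗ[ZMod 2] ({x // x ∉ U} → ZMod 2) where
  toFun h x := ∑ e : S.FreeEdge Γ, if x.1 ∈ e.1 then h e else 0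
  map_add' g h := by
    ext e
    simp only [Pi.add_apply, ← Finset.sum_add_distrib]
    exact Finset.sum_congr rfl fun t _ => by split_ifs <;> simp
  map_smul' c g := by
    ext e
    simp only [Pi.smul_apply, smul_eq_mul, RingHom.id_apply, Finset.mul_sum, mul_ite, mul_zero]

variable {S Γ}

/-- At a vertex outside `U` every edge of the triangulation is free, so each triangle there is
counted along exactly two edges, which cancel. -/
theorem starSum_coboundary {U : Finset X} (hU : ∀ x y, Γ.Adj x y → x ∈ U)
    (g : S.Triangle → ZMod 2) : S.starSum Γ U (S.coboundary Γ g) = 0 := by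
  ext ⟨x, hx⟩
  have hΓ : ∀ y, ¬ Γ.Adj x y := fun y h => hx (hU x y h)
  simp only [starSum, coboundary, LinearMap.coe_mk, AddHom.coe_mk, Pi.zero_apply]
  have h1 : ∀ e : S.FreeEdge Γ, (if x ∈ e.1 then
      ∑ t : S.Triangle, (if ∀ a ∈ e.1, a ∈ t.1 then g t else 0) else 0) =
      ∑ t : S.Triangle, if x ∈ e.1 ∧ ∀ a ∈ e.1, a ∈ t.1 then g t else 0 := by
    intro e
    by_cases h : x ∈ e.1 <;> simp [h]
  rw [Finset.sum_congr rfl fun e _ => h1 e, Finset.sum_comm]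
  refine Finset.sum_eq_zero fun t _ => ?_
  rw [← Finset.sum_filter, Finset.sum_const]
  by_cases hxt : x ∈ t.1
  · have h2 : (Finset.univ.filter fun e : S.FreeEdge Γ => x ∈ e.1 ∧ ∀ a ∈ e.1, a ∈ t.1).card =
        (t.1.erase x).card := by
      symm
      refine Finset.card_bij (fun y hy => ⟨s(x, y), ?_, ?_⟩) ?_ ?_ ?_
      · rw [Finset.mem_erase] at hy
        exact adj_of_mem t hxt hy.2 hy.1.symm
      · exact hΓ y
      · intro y hy
        rw [Finset.mem_erase] at hy
        simp [hxt, hy.2]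
      · intro y hy z hz h
        rw [Finset.mem_erase] at hy hz
        have h' := congrArg Subtype.val h
        rw [Sym2.eq_iff] at h'
        rcases h' with h' | h'
        · exact h'.2
        · exact (hy.1 h'.2).elim
      · rintro ⟨e, he⟩ h
        simp only [Finset.mem_filter, Finset.mem_univ, true_and] at h
        obtain ⟨⟨y, rfl⟩, h⟩ := h
        refine ⟨y, Finset.mem_erase.2 ⟨?_, h y (by simp)⟩, rfl⟩
        exact (S.skeleton.mem_edgeSet.1 he.1).ne'
    rw [h2, card_erase_triangle t hxt, two_nsmul, CharTwo.add_self_eq_zero]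
  · rw [Finset.filter_eq_empty_iff.2]
    · simp
    · intro e _ he
      exact hxt (he.2 x he.1)

/-- A free edge `xy` yields `δ x + δ y`, where `δ` vanishes on `U`; adding along a path to `U`
yields `δ x`. Edges of `Γ` on the path do no harm, as both ends are in `U`. -/
theorem range_starSum {U : Finset X} (hU : ∀ x y, Γ.Adj x y → x ∈ U) (hne : U.Nonempty) :
    LinearMap.range (S.starSum Γ U) = ⊤ := by
  let δ : X → ({x // x ∉ U} → ZMod 2) := fun y x => if x.1 = y then 1 else 0
  have hδ : ∀ x y, S.skeleton.Adj x y → δ x + δ y ∈ LinearMap.range (S.starSum Γ U) := by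
    intro x y hxy
    by_cases hΓ : Γ.Adj x y
    · have h0 : ∀ z ∈ U, δ z = 0 := fun z hz => by
        ext a
        exact if_neg fun h : a.1 = z => a.2 (h ▸ hz)
      rw [h0 x (hU x y hΓ), h0 y (hU y x hΓ.symm), add_zero]
      exact Submodule.zero_mem _
    · refine ⟨Pi.single ⟨s(x, y), hxy, hΓ⟩ 1, ?_⟩
      ext z
      simp only [starSum, LinearMap.coe_mk, AddHom.coe_mk, Pi.add_apply, δ]
      rw [Finset.sum_eq_single ⟨s(x, y), hxy, hΓ⟩]
      · have := hxy.ne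
        by_cases h1 : z.1 = x <;> by_cases h2 : z.1 = y <;> simp_all
      · intro e _ he
        simp [Pi.single_eq_of_ne he]
      · simp
  obtain ⟨u₀, hu₀⟩ := hne
  have hall : ∀ x, δ x ∈ LinearMap.range (S.starSum Γ U) := by
    intro x
    obtain ⟨p⟩ := S.connected.preconnected x u₀
    induction p with
    | nil =>
      convert Submodule.zero_mem _
      ext a
      exact if_neg fun h : a.1 = _ => a.2 (h ▸ hu₀)
    | cons hab _ ih =>
      have := Submodule.sub_mem _ (hδ _ _ hab) (ih hu₀)
      simpa using this
  rw [eq_top_iff]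
  intro v _
  have : v = ∑ x : {x // x ∉ U}, v x • δ x.1 := by
    ext a
    simp only [δ, Finset.sum_apply, Pi.smul_apply, smul_eq_mul, mul_ite, mul_one, mul_zero]
    rw [Finset.sum_eq_single a]
    · simp
    · intro b _ hb
      exact if_neg fun h => hb (Subtype.ext h).symm
    · simp
  rw [this]
  exact Submodule.sum_mem _ fun x _ => Submodule.smul_mem _ _ (hall x.1)

/-- A cochain in the kernel agrees on the two triangles at every free edge, so it is constant on
each face. -/
theorem ker_coboundary_le : LinearMap.ker (S.coboundary Γ) ≤
    LinearMap.range (LinearMap.funLeft (ZMod 2) (ZMod 2) (S.faceOf Γ)) := by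
  intro g hg
  have hadj : ∀ t t', (S.dualGraph Γ).Adj t t' → g t = g t' := by
    rintro t t' ⟨hne, x, y, hxy, h1, h2, h3, h4, h5⟩
    have h6 := congrFun (LinearMap.mem_ker.1 hg) ⟨s(x, y), adj_of_mem t h1 h2 hxy, h5⟩
    simp only [coboundary, LinearMap.coe_mk, AddHom.coe_mk, Pi.zero_apply, Sym2.mem_iff,
      forall_eq_or_imp, forall_eq] at h6
    have h7 : ({t, t'} : Finset S.Triangle) =
        Finset.univ.filter fun t : S.Triangle => x ∈ t.1 ∧ y ∈ t.1 := by
      refine Finset.eq_of_subset_of_card_le ?_ ?_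
      · intro s hs
        simp only [Finset.mem_insert, Finset.mem_singleton] at hs
        rcases hs with rfl | rfl <;> simp [*]
      · rw [card_triangles_of_adj (adj_of_mem t h1 h2 hxy), Finset.card_pair hne]
    rw [← Finset.sum_filter, ← h7, Finset.sum_pair hne] at h6
    exact CharTwo.add_eq_zero.1 h6
  refine ⟨SimpleGraph.ConnectedComponent.lift g fun t t' p _ => ?_, rfl⟩
  induction p with
  | nil => rfl
  | cons h _ ih => exact (hadj _ _ h).trans (ih (by simp_all [SimpleGraph.Walk.isPath_def]))

/-- Euler's inequality for a graph drawn in the 1-skeleton of a surface. -/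
theorem euler_inequality (hΓ : Γ ≤ S.skeleton) {U : Finset X} (hU : ∀ x y, Γ.Adj x y → x ∈ U)
    (hne : U.Nonempty) :
    S.eulerChar + Γ.edgeSet.ncard ≤ U.card + Fintype.card (S.GraphFace Γ) := by
  have h1 := LinearMap.finrank_range_add_finrank_ker (S.coboundary Γ)
  have h2 := LinearMap.finrank_range_add_finrank_ker (S.starSum Γ U)
  -- Rank and nullity of both maps turn this inclusion into `T - faces ≤ (free edges) - (vertices
  -- outside U)`, which is Euler's inequality rearranged.
  have h3 : Module.finrank (ZMod 2) (LinearMap.range (S.coboundary Γ)) ≤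
      Module.finrank (ZMod 2) (LinearMap.ker (S.starSum Γ U)) := by
    apply Submodule.finrank_mono
    rintro _ ⟨g, rfl⟩
    exact starSum_coboundary hU g
  have h4 := Submodule.finrank_mono (ker_coboundary_le (S := S) (Γ := Γ))
  have h5 := LinearMap.finrank_range_le (LinearMap.funLeft (ZMod 2) (ZMod 2) (S.faceOf Γ))
  rw [range_starSum hU hne, finrank_top] at h2
  simp only [Module.finrank_fintype_fun_eq_card] at h1 h2 h5
  have h6 : Fintype.card {x // x ∉ U} + U.card = Fintype.card X := by
    rw [Fintype.card_subtype_compl, Fintype.card_coe]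
    exact Nat.sub_add_cancel (Finset.card_le_univ U)
  have h7 : Fintype.card (S.FreeEdge Γ) + Γ.edgeSet.ncard = S.skeleton.edgeSet.ncard := by
    have hsub : Γ.edgeSet ⊆ S.skeleton.edgeSet := SimpleGraph.edgeSet_mono hΓ
    rw [← Set.ncard_sdiff_add_ncard_of_subset hsub, ← Nat.card_eq_fintype_card]
    rfl
  have h8 : Fintype.card S.Triangle = S.triangles.card := Fintype.card_coe _
  unfold eulerChar
  omega

/-- Each side of a face is counted from both ends, so 6 stands for a face of length three. -/
theorem six_le_sum_card_faceCorners (hΓ : Γ ≤ S.skeleton)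
    (h3 : ∃ s : Finset X, 3 ≤ s.card ∧ ∀ x ∈ s, ∃ y, Γ.Adj x y) (f : S.GraphFace Γ) :
    6 ≤ ∑ x : X, (S.faceCorners Γ f x).card := by
  have h1 := three_le_card_faceVertices hΓ h3 f
  have h2 : (S.faceVertices Γ f).card • 2 ≤ ∑ x ∈ S.faceVertices Γ f, (S.faceCorners Γ f x).card :=
    Finset.card_nsmul_le_sum _ _ _ fun x hx => two_le_card_faceCorners (mem_faceVertices.1 hx)
  have h4 : ∑ x ∈ S.faceVertices Γ f, (S.faceCorners Γ f x).card ≤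
      ∑ x : X, (S.faceCorners Γ f x).card :=
    Finset.sum_le_sum_of_subset (Finset.subset_univ _)
  rw [smul_eq_mul] at h2
  omega

/-- The number of edges of a graph drawn on a surface. -/
theorem ncard_edgeSet_le (hΓ : Γ ≤ S.skeleton) {U : Finset X} (hU : ∀ x y, Γ.Adj x y → x ∈ U)
    (h3 : ∃ s : Finset X, 3 ≤ s.card ∧ ∀ x ∈ s, ∃ y, Γ.Adj x y) :
    (Γ.edgeSet.ncard : ℤ) + 6 ≤ 3 * U.card + 3 * S.eulerGenus := by
  have hne : U.Nonempty := by
    obtain ⟨s, hs, hadj⟩ := h3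
    obtain ⟨x, hx⟩ := Finset.card_pos.1 (by omega : 0 < s.card)
    obtain ⟨y, hxy⟩ := hadj x hx
    exact ⟨x, hU x y hxy⟩
  have h1 := euler_inequality hΓ hU hne
  have h2 : ∑ _f : S.GraphFace Γ, 6 ≤ ∑ f : S.GraphFace Γ, ∑ x : X, (S.faceCorners Γ f x).card :=
    Finset.sum_le_sum fun f _ => six_le_sum_card_faceCorners hΓ h3 f
  rw [sum_card_faceCorners hΓ, Finset.sum_const, smul_eq_mul, Finset.card_univ] at h2
  unfold eulerGenus
  omega

/-! ### One distinguished face, and drawings that attain the edge bound. -/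

section Tight

variable {U A : Finset X} {F : S.GraphFace Γ}

theorem two_mul_card_le_sum (hΓ : Γ ≤ S.skeleton)
    (hA : ∀ x ∈ A, (∃ y, Γ.Adj x y) ∧ ∃ t : S.Triangle, S.faceOf Γ t = F ∧ x ∈ t.1)
    {B : Finset X} (hB : B ⊆ A) : B.card * 2 ≤ ∑ x ∈ B, (S.faceCorners Γ F x).card := by
  rw [← smul_eq_mul]
  refine Finset.card_nsmul_le_sum _ _ _ fun x hx => ?_
  obtain ⟨⟨y, hxy⟩, t, ht, hxt⟩ := hA x (hB hx)
  exact two_le_card_faceCorners (faceCorners_nonempty hΓ hxy hxt ht)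

/-- Euler's inequality with the number of faces eliminated by counting sides. `F` is kept apart, and
the other faces enter by their excess over a triangle, so that the equality case can be read off
term by term. -/
theorem sum_faces_ge (hΓ : Γ ≤ S.skeleton) (hU : ∀ x y, Γ.Adj x y → x ∈ U) (hne : U.Nonempty)
    (F : S.GraphFace Γ) :
    (∑ x : X, (S.faceCorners Γ F x).card : ℤ) +
      ∑ f ∈ Finset.univ.erase F, ((∑ x : X, (S.faceCorners Γ f x).card : ℤ) - 6) + 6 +
      2 * Γ.edgeSet.ncard ≤ 6 * U.card + 6 * S.eulerGenus := by
  have h1 := euler_inequality hΓ hU hne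
  have h2 := sum_card_faceCorners hΓ
  rw [← Finset.add_sum_erase _ _ (Finset.mem_univ F)] at h2
  have h3 : (Finset.univ.erase F).card + 1 = Fintype.card (S.GraphFace Γ) := by
    rw [Finset.card_erase_add_one (Finset.mem_univ F), Finset.card_univ]
  rw [Finset.sum_sub_distrib, Finset.sum_const, nsmul_eq_mul]
  have h4 : ((∑ x : X, (S.faceCorners Γ F x).card : ℕ) : ℤ) +
    ((∑ f ∈ Finset.univ.erase F, ∑ x : X, (S.faceCorners Γ f x).card : ℕ) : ℤ) =
      4 * Γ.edgeSet.ncard := by exact_mod_cast h2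
  push_cast at h4
  unfold eulerGenus
  omega

/-- The number of edges of a graph drawn on a surface with the vertices `A` on one face. -/
theorem ncard_edgeSet_add_card_le (hΓ : Γ ≤ S.skeleton) (hU : ∀ x y, Γ.Adj x y → x ∈ U)
    (h3 : ∃ s : Finset X, 3 ≤ s.card ∧ ∀ x ∈ s, ∃ y, Γ.Adj x y) (hne : U.Nonempty)
    (hA : ∀ x ∈ A, (∃ y, Γ.Adj x y) ∧ ∃ t : S.Triangle, S.faceOf Γ t = F ∧ x ∈ t.1) :
    (Γ.edgeSet.ncard : ℤ) + A.card + 3 ≤ 3 * U.card + 3 * S.eulerGenus := by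
  have h1 := sum_faces_ge hΓ hU hne F
  have h2 := (two_mul_card_le_sum hΓ hA subset_rfl).trans
    (Finset.sum_le_sum_of_subset (Finset.subset_univ _))
  have h4 : 0 ≤ ∑ f ∈ Finset.univ.erase F, ((∑ x : X, (S.faceCorners Γ f x).card : ℤ) - 6) :=
    Finset.sum_nonneg fun f _ => by
      have := six_le_sum_card_faceCorners hΓ h3 f
      rw [sub_nonneg]
      exact_mod_cast this
  have h5 : (A.card : ℤ) * 2 ≤ ∑ x : X, (S.faceCorners Γ F x).card := by exact_mod_cast h2
  push_cast at h5
  omega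

theorem sum_eq_of_tight (hΓ : Γ ≤ S.skeleton) (hU : ∀ x y, Γ.Adj x y → x ∈ U)
    (h3 : ∃ s : Finset X, 3 ≤ s.card ∧ ∀ x ∈ s, ∃ y, Γ.Adj x y) (hne : U.Nonempty)
    (hA : ∀ x ∈ A, (∃ y, Γ.Adj x y) ∧ ∃ t : S.Triangle, S.faceOf Γ t = F ∧ x ∈ t.1)
    (htight : 3 * (U.card : ℤ) + 3 * S.eulerGenus ≤ Γ.edgeSet.ncard + A.card + 3) :
    (∀ f ≠ F, ∑ x : X, (S.faceCorners Γ f x).card = 6) ∧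
      ∑ x : X, (S.faceCorners Γ F x).card = A.card * 2 := by
  have h1 := sum_faces_ge hΓ hU hne F
  have h2 := (two_mul_card_le_sum hΓ hA subset_rfl).trans
    (Finset.sum_le_sum_of_subset (Finset.subset_univ _))
  have h6 : ∀ f : S.GraphFace Γ, (0 : ℤ) ≤ (∑ x : X, (S.faceCorners Γ f x).card : ℤ) - 6 := by
    intro f
    have := six_le_sum_card_faceCorners hΓ h3 f
    rw [sub_nonneg]
    exact_mod_cast this
  have h4 : 0 ≤ ∑ f ∈ Finset.univ.erase F, ((∑ x : X, (S.faceCorners Γ f x).card : ℤ) - 6) :=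
    Finset.sum_nonneg fun f _ => h6 f
  have h5 : (A.card : ℤ) * 2 ≤ ∑ x : X, (S.faceCorners Γ F x).card := by exact_mod_cast h2
  push_cast at h5
  constructor
  · intro f hf
    have h7 : ∑ f ∈ Finset.univ.erase F, ((∑ x : X, (S.faceCorners Γ f x).card : ℤ) - 6) = 0 := by
      omega
    have h8 := (Finset.sum_eq_zero_iff_of_nonneg fun f _ => h6 f).1 h7 f
      (Finset.mem_erase.2 ⟨hf, Finset.mem_univ _⟩)
    have h9 : ((∑ x : X, (S.faceCorners Γ f x).card : ℕ) : ℤ) = 6 := by push_cast; omega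
    exact_mod_cast h9
  · have h9 : ((∑ x : X, (S.faceCorners Γ F x).card : ℕ) : ℤ) = A.card * 2 := by push_cast; omega
    exact_mod_cast h9

theorem card_faceCorners_le_two_of_sum (hΓ : Γ ≤ S.skeleton)
    (hA : ∀ x ∈ A, (∃ y, Γ.Adj x y) ∧ ∃ t : S.Triangle, S.faceOf Γ t = F ∧ x ∈ t.1)
    (hsum : ∑ x : X, (S.faceCorners Γ F x).card = A.card * 2) (x : X) :
    (S.faceCorners Γ F x).card ≤ 2 := by
  rw [← Finset.add_sum_erase _ _ (Finset.mem_univ x)] at hsum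
  have h1 := two_mul_card_le_sum hΓ hA (Finset.erase_subset x A)
  have h2 : ∑ y ∈ A.erase x, (S.faceCorners Γ F y).card ≤
      ∑ y ∈ Finset.univ.erase x, (S.faceCorners Γ F y).card :=
    Finset.sum_le_sum_of_subset (Finset.erase_subset_erase _ (Finset.subset_univ _))
  have h3 := Finset.pred_card_le_card_erase (s := A) (a := x)
  omega

/-- A face with three sides is bounded by a triangle. -/
theorem adj_of_sum_eq_six {f : S.GraphFace Γ} (hsum : ∑ x : X, (S.faceCorners Γ f x).card = 6)
    {w u u' : X} {t t' : S.Triangle} (hu : (u, t) ∈ S.faceCorners Γ f w)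
    (hu' : (u', t') ∈ S.faceCorners Γ f w) (hne : u ≠ u') : Γ.Adj u u' := by
  have hwu : w ≠ u := (mem_faceCorners.1 hu).1.ne
  have hwu' : w ≠ u' := (mem_faceCorners.1 hu').1.ne
  have h0 : ∀ x, (S.faceCorners Γ f x).Nonempty → 2 ≤ (S.faceCorners Γ f x).card :=
    fun x h => two_le_card_faceCorners h
  have hw2 := h0 w ⟨_, hu⟩
  have hu2 := h0 u ⟨_, faceCorners_nonempty_symm hu⟩
  have hu2' := h0 u' ⟨_, faceCorners_nonempty_symm hu'⟩
  have h1 : ∑ x ∈ {w, u, u'}, (S.faceCorners Γ f x).card =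
      (S.faceCorners Γ f w).card + ((S.faceCorners Γ f u).card + (S.faceCorners Γ f u').card) := by
    rw [Finset.sum_insert (by simp [hwu, hwu']), Finset.sum_pair hne]
  have h2 := Finset.sum_le_sum_of_subset (f := fun x => (S.faceCorners Γ f x).card)
    (Finset.subset_univ {w, u, u'})
  have hwcard : (S.faceCorners Γ f w).card = 2 := by omega
  have hwset : ({(u, t), (u', t')} : Finset (X × S.Triangle)) = S.faceCorners Γ f w := by
    refine Finset.eq_of_subset_of_card_le ?_ ?_
    · intro a ha
      simp only [Finset.mem_insert, Finset.mem_singleton] at ha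
      rcases ha with rfl | rfl <;> assumption
    · rw [Finset.card_pair (by simp [hne]), hwcard]
  -- Follow the face from `u` along its other side. An end `z` different from `w` and `u'` would be
  -- a fourth vertex, and four vertices count at least 8.
  obtain ⟨⟨z, s⟩, hz, hzt⟩ := Finset.exists_mem_ne (show 1 < (S.faceCorners Γ f u).card by omega)
    (w, t)
  have hzw : z ≠ w := by
    rintro rfl
    have h := faceCorners_nonempty_symm hz
    rw [← hwset] at h
    simp only [Finset.mem_insert, Finset.mem_singleton, Prod.mk.injEq, true_and] at h
    rcases h with h | h
    · exact hzt (by rw [h])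
    · exact hne h.1
  have huz := (mem_faceCorners.1 hz).1
  by_cases hzu' : z = u'
  · rwa [← hzu']
  exfalso
  have hz2 := h0 z ⟨_, faceCorners_nonempty_symm hz⟩
  have h4 : ∑ x ∈ {z, w, u, u'}, (S.faceCorners Γ f x).card = (S.faceCorners Γ f z).card +
      ((S.faceCorners Γ f w).card + ((S.faceCorners Γ f u).card + (S.faceCorners Γ f u').card)) := by
    rw [Finset.sum_insert (by simp [hzw, hzu', huz.ne']), h1]
  have h5 := Finset.sum_le_sum_of_subset (f := fun x => (S.faceCorners Γ f x).card)
    (Finset.subset_univ {z, w, u, u'})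
  omega

/-- A set of neighbours of `w` that is closed under sharing a face other than `F` contains all
neighbours, or has at least two sides on `F`. -/
theorem forall_or_two_le_card_corners (hΓ : Γ ≤ S.skeleton) {w : X} {Q : X → Prop}
    (hQ : ∀ f ≠ F, ∀ u s u' s', (u, s) ∈ S.faceCorners Γ f w → (u', s') ∈ S.faceCorners Γ f w →
      Q u → Q u') {u₀ : X} (hu₀ : Γ.Adj w u₀) (hQ₀ : Q u₀) :
    (∀ y, Γ.Adj w y → Q y) ∨
      2 ≤ (S.corners (fun t => S.faceOf Γ t = F) (fun y => Γ.Adj w y ∧ Q y) w).card := by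
  set Y : X → Prop := fun y => Γ.Adj w y ∧ Q y with hY
  -- `P` collects the triangles outside `F` whose face has a side at `w` towards a neighbour in `Q`.
  -- Its borders are exactly the sides outside `F` of the edges in `Y`. Their number is even, and so
  -- is that of all sides of those edges; hence the sides on `F` number zero or at least two.
  set P : S.Triangle → Prop := fun t => S.faceOf Γ t ≠ F ∧
    ∃ u s, (u, s) ∈ S.faceCorners Γ (S.faceOf Γ t) w ∧ Q u with hP
  have hclosed : ∀ y, y ≠ w → ¬ Y y → ∀ t t' : S.Triangle, w ∈ t.1 → y ∈ t.1 → w ∈ t'.1 →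
      y ∈ t'.1 → P t → P t' := by
    rintro y hyw hYy t t' h1 h2 h3 h4 ⟨h5, u, s, hus, hQu⟩
    have hadj : ¬ Γ.Adj w y := fun h =>
      hYy ⟨h, hQ _ h5 u s y t hus (mem_faceCorners.2 ⟨h, h1, h2, rfl⟩) hQu⟩
    have := faceOf_eq hyw.symm hadj h1 h2 h3 h4
    refine ⟨this ▸ h5, u, s, ?_, hQu⟩
    rwa [← this]
  have hPY : ∀ t : S.Triangle, ∀ y, Y y → w ∈ t.1 → y ∈ t.1 → S.faceOf Γ t ≠ F → P t :=
    fun t y hy hw hyt hF => ⟨hF, y, t, mem_faceCorners.2 ⟨hy.1, hw, hyt, rfl⟩, hy.2⟩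
  have heven := even_card_corners hclosed
  have heq : S.corners P Y w =
      S.corners (fun t => True ∧ ¬ S.faceOf Γ t = F) Y w := by
    ext p
    simp only [mem_corners]
    constructor
    · rintro ⟨h1, h2, h3, h4, h5⟩
      exact ⟨h1, h2, h3, h4, trivial, h5.1⟩
    · rintro ⟨h1, h2, h3, h4, h5⟩
      exact ⟨h1, h2, h3, h4, hPY _ _ h2 h3 h4 h5.2⟩
  have hsplit := card_corners_split' (S := S) (fun _ => True) (fun t => S.faceOf Γ t = F) Y w
  have hall : Even (S.corners (fun _ => True) Y w).card :=
    even_card_corners fun _ _ _ _ _ _ _ _ _ h => h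
  rw [← heq] at hsplit
  simp only [true_and] at hsplit
  rw [← hsplit, Nat.even_add] at hall
  obtain ⟨k, hk⟩ := hall.2 heven
  rcases Nat.eq_zero_or_pos k with rfl | hkpos
  · left
    have hempty : S.corners (fun t => S.faceOf Γ t = F) Y w = ∅ := by
      rw [← Finset.card_eq_zero]; omega
    have hnF : ∀ t : S.Triangle, ∀ y, Y y → w ∈ t.1 → y ∈ t.1 → S.faceOf Γ t ≠ F := by
      intro t y hy hw hyt hF
      have : (y, t) ∈ S.corners (fun t => S.faceOf Γ t = F) Y w :=
        mem_corners.2 ⟨hy.1.ne', hy, hw, hyt, hF⟩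
      rw [hempty] at this
      simp at this
    obtain ⟨t₀, hw₀, hut₀⟩ := exists_triangle_of_adj (hΓ hu₀)
    have hPall := forall_triangle_at (P := P) (fun y hy t t' h1 h2 h3 h4 h5 => by
      by_cases hYy : Y y
      · exact hPY t' y hYy h3 h4 (hnF t' y hYy h3 h4)
      · exact hclosed y hy hYy t t' h1 h2 h3 h4 h5) hw₀
      (hPY t₀ u₀ ⟨hu₀, hQ₀⟩ hw₀ hut₀ (hnF t₀ u₀ ⟨hu₀, hQ₀⟩ hw₀ hut₀))
    intro y hy
    obtain ⟨t, hwt, hyt⟩ := exists_triangle_of_adj (hΓ hy)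
    obtain ⟨h5, u, s, hus, hQu⟩ := hPall t hwt
    exact hQ _ h5 u s y t hus (mem_faceCorners.2 ⟨hy, hwt, hyt, rfl⟩) hQu
  · right
    omega

/-- The complement of `Q` is closed as well. If both contained neighbours of `w`, each would have
two sides on `F`, four in all. -/
theorem forall_adj_of_closed (hΓ : Γ ≤ S.skeleton) {w : X} {Q : X → Prop}
    (hF : (S.faceCorners Γ F w).card ≤ 2)
    (hQ : ∀ f ≠ F, ∀ u s u' s', (u, s) ∈ S.faceCorners Γ f w → (u', s') ∈ S.faceCorners Γ f w →
      Q u → Q u') {u₀ : X} (hu₀ : Γ.Adj w u₀) (hQ₀ : Q u₀) : ∀ y, Γ.Adj w y → Q y := by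
  rcases forall_or_two_le_card_corners hΓ hQ hu₀ hQ₀ with h | h
  · exact h
  intro y hy
  by_contra hQy
  rcases forall_or_two_le_card_corners (F := F) (Q := fun y => ¬ Q y) hΓ
    (fun f hf u s u' s' hu hu' hnu hu'Q => hnu (hQ f hf u' s' u s hu' hu hu'Q)) hy hQy with h' | h'
  · exact h' u₀ hu₀ hQ₀
  · have := card_corners_split (S := S) (fun t => S.faceOf Γ t = F) Q (Γ.Adj w) w
    unfold faceCorners at hF
    omega

/-- In a drawing that meets the bound on the number of edges and contains no induced diamond,
the neighbours of each vertex are pairwise adjacent. -/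
theorem adj_of_tight (hΓ : Γ ≤ S.skeleton) (hU : ∀ x y, Γ.Adj x y → x ∈ U)
    (h3 : ∃ s : Finset X, 3 ≤ s.card ∧ ∀ x ∈ s, ∃ y, Γ.Adj x y) (hne : U.Nonempty)
    (hA : ∀ x ∈ A, (∃ y, Γ.Adj x y) ∧ ∃ t : S.Triangle, S.faceOf Γ t = F ∧ x ∈ t.1)
    (htight : 3 * (U.card : ℤ) + 3 * S.eulerGenus ≤ Γ.edgeSet.ncard + A.card + 3)
    (hdia : ∀ w u p q, Γ.Adj w u → Γ.Adj w p → Γ.Adj w q → Γ.Adj u p → Γ.Adj u q → p ≠ q →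
      Γ.Adj p q) {w u v : X} (hu : Γ.Adj w u) (hv : Γ.Adj w v) (huv : u ≠ v) : Γ.Adj u v := by
  obtain ⟨h6, hsum⟩ := sum_eq_of_tight hΓ hU h3 hne hA htight
  -- The closed neighbourhood of `u` spreads around `w`: if a triangular face joins `a` to `b` and
  -- `a` is adjacent to `u`, then `w`, `a`, `u`, `b` form a diamond, so `b` is adjacent to `u`.
  have := forall_adj_of_closed (Q := fun y => y = u ∨ Γ.Adj u y) hΓ
    (card_faceCorners_le_two_of_sum hΓ hA hsum w) ?_ hu (Or.inl rfl) v hv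
  · exact this.resolve_left huv.symm
  · intro f hf a s b s' ha hb hQa
    by_cases hab : a = b
    · rwa [← hab]
    have hadj := adj_of_sum_eq_six (h6 f hf) ha hb hab
    by_cases hbu : b = u
    · exact Or.inl hbu
    rcases hQa with rfl | hua
    · exact Or.inr hadj
    · exact Or.inr (hdia w a u b (mem_faceCorners.1 ha).1 hu (mem_faceCorners.1 hb).1 hua.symm hadj
        (Ne.symm hbu))

end Tight

end ClosedSurface

/-! ### From the embedded graph to its drawing in the 1-skeleton. -/

namespace SurfaceEmbedding

open scoped Classical

variable {V : Type u} {G : SimpleGraph V} {X : Type v} [Fintype X] {S : ClosedSurface X}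

/-- The drawing of the subgraph of `G` induced on `W`. -/
def drawing (φ : SurfaceEmbedding G S) (W : Finset V) : SimpleGraph X where
  Adj x y := ∃ u ∈ W, ∃ w ∈ W, G.Adj u w ∧ φ u = x ∧ φ w = y
  symm := ⟨fun _ _ ⟨u, hu, w, hw, h, hx, hy⟩ => ⟨w, hw, u, hu, h.symm, hy, hx⟩⟩
  loopless := ⟨fun _ ⟨_, _, _, _, h, hx, hy⟩ => h.ne (φ.injective (hx.trans hy.symm))⟩

variable (φ : SurfaceEmbedding G S) {W : Finset V}

theorem drawing_le : φ.drawing W ≤ S.skeleton := by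
  rintro _ _ ⟨u, _, w, _, h, rfl, rfl⟩
  exact φ.toHom.map_adj h

theorem drawing_adj {u w : V} :
    (φ.drawing W).Adj (φ u) (φ w) ↔ u ∈ W ∧ w ∈ W ∧ G.Adj u w := by
  constructor
  · rintro ⟨a, ha, b, hb, h, hx, hy⟩
    rw [← φ.injective hx, ← φ.injective hy]
    exact ⟨ha, hb, h⟩
  · rintro ⟨hu, hw, h⟩
    exact ⟨u, hu, w, hw, h, rfl, rfl⟩

theorem mem_image_of_drawing_adj (x y : X) (h : (φ.drawing W).Adj x y) : x ∈ W.image φ := by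
  obtain ⟨u, hu, _, _, _, rfl, _⟩ := h
  exact Finset.mem_image_of_mem _ hu

theorem card_image_vertices : (W.image φ).card = W.card :=
  Finset.card_image_of_injective _ φ.injective

theorem degree_drawing {u : V} (hu : u ∈ W) :
    (φ.drawing W).degree (φ u) = degreeIn G W u := by
  rw [← SimpleGraph.card_neighborFinset_eq_degree, degreeIn,
    ← Finset.card_image_of_injective _ φ.injective]
  congr 1
  ext x
  simp only [SimpleGraph.mem_neighborFinset, Finset.mem_image, Finset.mem_filter]
  constructor
  · rintro ⟨a, ha, b, hb, h, hx, rfl⟩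
    rw [φ.injective hx] at h
    exact ⟨b, ⟨hb, h⟩, rfl⟩
  · rintro ⟨b, ⟨hb, h⟩, rfl⟩
    exact φ.drawing_adj.2 ⟨hu, hb, h⟩

theorem two_mul_ncard_edgeSet_drawing :
    2 * (φ.drawing W).edgeSet.ncard = ∑ u ∈ W, degreeIn G W u := by
  rw [← SimpleGraph.coe_edgeFinset, Set.ncard_coe_finset,
    ← SimpleGraph.sum_degrees_eq_twice_card_edges, ← Finset.sum_subset
      (Finset.subset_univ (W.image φ)), Finset.sum_image (g := φ) fun _ _ _ _ h => φ.injective h]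
  · exact Finset.sum_congr rfl fun u hu => φ.degree_drawing hu
  · intro x _ hx
    rw [← SimpleGraph.card_neighborFinset_eq_degree, Finset.card_eq_zero,
      Finset.eq_empty_iff_forall_notMem]
    intro y hy
    rw [SimpleGraph.mem_neighborFinset] at hy
    exact hx (φ.mem_image_of_drawing_adj x y hy)

theorem exists_drawing_adj {u : V} (hu : u ∈ W) (hd : 0 < degreeIn G W u) :
    ∃ y, (φ.drawing W).Adj (φ u) y := by
  obtain ⟨w, hw⟩ := Finset.card_pos.1 hd
  rw [Finset.mem_filter] at hw
  exact ⟨φ w, φ.drawing_adj.2 ⟨hu, hw.1, hw.2⟩⟩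

theorem exists_three_drawing_adj (hW : 3 ≤ W.card) (hd : ∀ u ∈ W, 0 < degreeIn G W u) :
    ∃ s : Finset X, 3 ≤ s.card ∧ ∀ x ∈ s, ∃ y, (φ.drawing W).Adj x y := by
  refine ⟨W.image φ, φ.card_image_vertices.symm ▸ hW, fun x hx => ?_⟩
  obtain ⟨u, hu, rfl⟩ := Finset.mem_image.1 hx
  exact φ.exists_drawing_adj hu (hd u hu)

/-- The faces of `G` are contained in the faces of its subgraphs. -/
theorem exists_face_drawing (F : φ.Face) (W : Finset V) :
    ∃ F' : S.GraphFace (φ.drawing W), ∀ w, φ.OnFace F w →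
      ∃ t : S.Triangle, S.faceOf (φ.drawing W) t = F' ∧ φ w ∈ t.1 := by
  obtain ⟨t₀, rfl⟩ := Quot.exists_rep F
  refine ⟨S.faceOf _ t₀, fun w hw => ?_⟩
  obtain ⟨t, ht, hwt⟩ := hw
  refine ⟨t, ?_, hwt⟩
  have hle : φ.crossing ≤ S.dualGraph (φ.drawing W) := by
    rintro s s' ⟨hne, x, y, hxy, h1, h2, h3, h4, h5⟩
    exact ⟨hne, x, y, hxy, h1, h2, h3, h4, fun ⟨u, _, w, _, h, hx, hy⟩ => h5 ⟨u, w, h, hx, hy⟩⟩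
  exact SimpleGraph.ConnectedComponent.sound
    ((SimpleGraph.ConnectedComponent.exact ht).mono hle)

theorem not_isNClique_heawood_add_one (φ : SurfaceEmbedding G S) {ε : ℕ} (hε : 1 ≤ ε) (hS : S.eulerGenus = (ε : ℤ))
    (s : Finset V) : ¬ G.IsNClique (heawood ε + 1) s := by
  intro hs
  have hH := six_le_heawood hε
  have hd : ∀ u ∈ s, degreeIn G s u = heawood ε := by
    intro u hu
    have h1 : s.filter (G.Adj u) = s.erase u := by
      ext a
      simp only [Finset.mem_filter, Finset.mem_erase]
      exact ⟨fun h => ⟨h.2.ne', h.1⟩, fun h => ⟨h.2, hs.isClique hu h.2 h.1.symm⟩⟩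
    rw [degreeIn, h1, Finset.card_erase_of_mem hu, hs.card_eq, Nat.add_sub_cancel]
  have h1 := ClosedSurface.ncard_edgeSet_le φ.drawing_le (φ.mem_image_of_drawing_adj (W := s))
    (φ.exists_three_drawing_adj (by rw [hs.card_eq]; omega) fun u hu => by rw [hd u hu]; omega)
  have h2 := φ.two_mul_ncard_edgeSet_drawing (W := s)
  rw [Finset.sum_congr rfl hd, Finset.sum_const, smul_eq_mul, hs.card_eq] at h2
  rw [φ.card_image_vertices, hs.card_eq, hS] at h1
  have h3 := heawood_mul_lt ε
  generalize heawood ε = H at *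
  zify at h2 h3
  push_cast at h1
  nlinarith

end SurfaceEmbedding

/-! ### Combining the coloring arguments with the edge counts. -/

theorem listColorable_of_listColorableOn_univ {V : Type u} [Fintype V] {G : SimpleGraph V}
    {L : V → Finset ℕ} (h : ListColorableOn G L Finset.univ) : ListColorable G L := by
  obtain ⟨c, h1, h2⟩ := h
  exact ⟨SimpleGraph.Coloring.mk c fun {a b} hab => h2 a (Finset.mem_univ _) b (Finset.mem_univ _)
    hab, fun w => h1 w (Finset.mem_univ _)⟩

open scoped Classical in
theorem sum_card_lists {V : Type u} {L : V → Finset ℕ} {W A : Finset V} {H : ℕ} (hH : 2 ≤ H)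
    (hA : A ⊆ W) (hLA : ∀ v ∈ A, (L v).card = H - 2) (hLB : ∀ v ∈ W, v ∉ A → (L v).card = H) :
    ∑ v ∈ W, (L v).card + 2 * A.card = H * W.card := by
  have h1 := Finset.sum_sdiff hA (f := fun v => (L v).card)
  have h2 := Finset.card_sdiff_add_card_eq_card hA
  rw [Finset.sum_congr rfl hLA, Finset.sum_const, smul_eq_mul,
    Finset.sum_congr rfl fun v hv => hLB v (Finset.mem_sdiff.1 hv).1 (Finset.mem_sdiff.1 hv).2,
    Finset.sum_const, smul_eq_mul] at h1
  obtain ⟨k, rfl⟩ := Nat.exists_eq_add_of_le hH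
  rw [← h1, ← h2]
  simp only [Nat.add_sub_cancel_left]
  ring

open scoped Classical in
/-- The lists of the lemma admit no critical set in which the drawing is as dense as possible. -/
theorem not_listCritical_of_tight {V : Type u} {G : SimpleGraph V} {X : Type v} [Fintype X]
    {S : ClosedSurface X} (φ : SurfaceEmbedding G S) {F : φ.Face} {ε : ℕ} (hε : 1 ≤ ε)
    (hS : S.eulerGenus = (ε : ℤ)) {L : V → Finset ℕ} {W A : Finset V} (hc : ListCritical G L W)
    (hA : A ⊆ W) (hAF : ∀ w ∈ A, φ.OnFace F w) (hLA : ∀ v ∈ A, (L v).card = heawood ε - 2)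
    (hLB : ∀ v ∈ W, v ∉ A → (L v).card = heawood ε)
    (hcl : ∀ s ⊆ A, ¬ G.IsNClique (heawood ε - 1) s) (hW : 3 ≤ W.card)
    (hnum : 6 * ε + 6 * W.card ≤ heawood ε * W.card + 6) : False := by
  have hH := six_le_heawood hε
  have hdeg : ∀ v ∈ W, (L v).card ≤ degreeIn G W v := fun v hv => hc.card_le_degreeIn hv
  have hpos : ∀ v ∈ W, 0 < degreeIn G W v := fun v hv => by
    have h1 := hdeg v hv
    by_cases h : v ∈ A
    · have := hLA v h; omega
    · have := hLB v hv h; omega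
  obtain ⟨F', hF'⟩ := φ.exists_face_drawing F W
  have hU := φ.mem_image_of_drawing_adj (W := W)
  have h3 := φ.exists_three_drawing_adj hW hpos
  obtain ⟨w₀, hw₀⟩ := Finset.card_pos.1 (by omega : 0 < W.card)
  have hne : (W.image φ).Nonempty := ⟨_, Finset.mem_image_of_mem _ hw₀⟩
  have hA' : ∀ x ∈ A.image φ, (∃ y, (φ.drawing W).Adj x y) ∧
      ∃ t : S.Triangle, S.faceOf (φ.drawing W) t = F' ∧ x ∈ t.1 := by
    intro x hx
    obtain ⟨a, ha, rfl⟩ := Finset.mem_image.1 hx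
    exact ⟨φ.exists_drawing_adj (hA ha) (hpos a (hA ha)), hF' a (hAF a ha)⟩
  have hbound := ClosedSurface.ncard_edgeSet_add_card_le φ.drawing_le hU h3 hne hA'
  have hE := φ.two_mul_ncard_edgeSet_drawing (W := W)
  have hsum := sum_card_lists (by omega) hA hLA hLB
  have hle := Finset.sum_le_sum hdeg
  rw [φ.card_image_vertices, φ.card_image_vertices, hS] at hbound
  -- By `hnum` the Euler bound on the sum of the degrees does not exceed the sum of the list sizes,
  -- so no vertex can have degree above its list size.
  have hzero : ∀ v ∈ W, (L v).card = degreeIn G W v :=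
    (Finset.sum_eq_sum_iff_of_le hdeg).1 (by omega)
  have hadj : ∀ {w u v}, w ∈ W → u ∈ W → v ∈ W → G.Adj w u → G.Adj w v → u ≠ v →
      G.Adj u v := by
    intro w u v hw hu hv hwu hwv huv
    refine (φ.drawing_adj.1 (ClosedSurface.adj_of_tight φ.drawing_le hU h3 hne hA' ?_ ?_
      (φ.drawing_adj.2 ⟨hw, hu, hwu⟩) (φ.drawing_adj.2 ⟨hw, hv, hwv⟩)
      (fun h => huv (φ.injective h)))).2.2
    · rw [φ.card_image_vertices, φ.card_image_vertices, hS]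
      omega
    · rintro _ _ p q ⟨w, hw, u, hu, hwu, rfl, rfl⟩ hwp hwq hup huq hpq
      obtain ⟨p, _, rfl⟩ := Finset.mem_image.1 (hU _ _ hwp.symm)
      obtain ⟨q, _, rfl⟩ := Finset.mem_image.1 (hU _ _ hwq.symm)
      rw [φ.drawing_adj] at hwp hwq hup huq ⊢
      exact ⟨hwp.2.1, hwq.2.1, hc.adj_of_diamond hw hu hwp.2.1 hwq.2.1 (hzero w hw).ge
        (hzero u hu).ge (hzero p hwp.2.1).ge (hzero q hwq.2.1).ge hwu hwp.2.2 hwq.2.2 hup.2.2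
        huq.2.2 (fun h => hpq (h ▸ rfl))⟩
  have hclique : ∀ w ∈ W, G.IsNClique (degreeIn G W w + 1) (insert w (W.filter (G.Adj w))) := by
    intro w hw
    refine ⟨?_, ?_⟩
    · rw [Finset.coe_insert, SimpleGraph.isClique_insert]
      refine ⟨fun a ha b hb hab => ?_, fun b hb _ => ?_⟩
      · rw [Finset.mem_coe, Finset.mem_filter] at ha hb
        exact hadj hw ha.1 hb.1 ha.2 hb.2 hab
      · exact (Finset.mem_filter.1 hb).2
    · rw [Finset.card_insert_of_notMem (by simp), degreeIn]
  by_cases hWA : W ⊆ A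
  · have h1 := hclique w₀ hw₀
    rw [← hzero w₀ hw₀, hLA w₀ (hWA hw₀), show heawood ε - 2 + 1 = heawood ε - 1 by omega] at h1
    exact hcl _ ((Finset.insert_subset hw₀ (Finset.filter_subset _ _)).trans hWA) h1
  · obtain ⟨w, hw, hwA⟩ := Finset.not_subset.1 hWA
    have h1 := hclique w hw
    rw [← hzero w hw, hLB w hw hwA] at h1
    exact φ.not_isNClique_heawood_add_one hε hS _ h1

open scoped Classical in
theorem sum_degreeIn_le {V : Type u} {G : SimpleGraph V} {X : Type v} [Fintype X]
    {S : ClosedSurface X} (φ : SurfaceEmbedding G S) {F : φ.Face} {W A : Finset V}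
    (hA : A ⊆ W) (hAF : ∀ w ∈ A, φ.OnFace F w) (hpos : ∀ v ∈ W, 0 < degreeIn G W v)
    (hW : 3 ≤ W.card) :
    (∑ v ∈ W, degreeIn G W v : ℤ) + 2 * A.card + 6 ≤ 6 * W.card + 6 * S.eulerGenus := by
  obtain ⟨F', hF'⟩ := φ.exists_face_drawing F W
  obtain ⟨w₀, hw₀⟩ := Finset.card_pos.1 (by omega : 0 < W.card)
  have hbound := ClosedSurface.ncard_edgeSet_add_card_le (U := W.image φ) (A := A.image φ)
    (F := F') φ.drawing_le φ.mem_image_of_drawing_adj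
    (φ.exists_three_drawing_adj hW hpos) ⟨_, Finset.mem_image_of_mem _ hw₀⟩ (by
      intro x hx
      obtain ⟨a, ha, rfl⟩ := Finset.mem_image.1 hx
      exact ⟨φ.exists_drawing_adj (hA ha) (hpos a (hA ha)), hF' a (hAF a ha)⟩)
  have hE := φ.two_mul_ncard_edgeSet_drawing (W := W)
  rw [φ.card_image_vertices, φ.card_image_vertices] at hbound
  zify at hE
  omega

open scoped Classical in
/-- The property holds for every number of vertices, without assuming the case `H(ε) + 1`. -/
theorem heawoodListProperty {ε : ℕ} (hε : 1 ≤ ε) (hε3 : ε ≠ 3) (n : ℕ) :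
    HeawoodListProperty.{u, v} ε n := by
  intro V _ G _ X _ S hS φ F L hLF hLnF hclique
  by_contra hcol
  obtain ⟨W, _, hc⟩ := exists_listCritical_subset
    fun h => hcol (listColorable_of_listColorableOn_univ h)
  have hH := six_le_heawood hε
  set A := W.filter fun w => φ.OnFace F w
  have hA : A ⊆ W := Finset.filter_subset _ _
  have hAF : ∀ w ∈ A, φ.OnFace F w := fun w hw => (Finset.mem_filter.1 hw).2
  have hLA : ∀ v ∈ A, (L v).card = heawood ε - 2 := fun v hv => hLF v (hAF v hv)
  have hLB : ∀ v ∈ W, v ∉ A → (L v).card = heawood ε := fun v hv hvA =>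
    hLnF v fun h => hvA (Finset.mem_filter.2 ⟨hv, h⟩)
  have hcl : ∀ s ⊆ A, ¬ G.IsNClique (heawood ε - 1) s := fun s hs h =>
    hclique ⟨s, h, fun w hw => hAF w (hs hw)⟩
  have hcard := not_listCritical_of_card_le hH hc hA hLA hLB hcl
  have htight : ¬ 6 * ε + 6 * W.card ≤ heawood ε * W.card + 6 := fun h =>
    not_listCritical_of_tight φ hε hS hc hA hAF hLA hLB hcl (by omega) h
  have hH10 : 10 ≤ heawood ε := by
    by_contra! hlt
    have h1 := heawood_mul_le_of_lt hε hε3 hlt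
    apply htight
    nlinarith
  have h4 := heawood_mul_le ε
  -- With `H + 2` vertices, tightness needs `6ε ≤ H² - 4H - 6`; this follows from `heawood_mul_le`
  -- exactly when `H ≥ 10`.
  have hcard' : W.card = heawood ε + 1 := by
    by_contra hne
    have : heawood ε + 2 ≤ W.card := by omega
    apply htight
    nlinarith
  have h1 := not_listCritical_of_card_lt hH hc hA hcard' hLA hLB hcl
    (φ.not_isNClique_heawood_add_one hε hS W)
  have hpos : ∀ v ∈ W, 0 < degreeIn G W v := fun v hv => by
    have h1 := hc.card_le_degreeIn hv
    by_cases h : v ∈ A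
    · have := hLA v h; omega
    · have := hLB v hv h; omega
  have hdeg := sum_degreeIn_le φ hA hAF hpos (by omega)
  have hsum := sum_card_lists (by omega) hA hLA hLB
  -- The excess of the degrees over the list sizes is at most `6ε + 5H - H² ≤ 4`.
  refine absurd (not_listCritical_of_sum_le hH10 hc hA hcard' hLA hLB ?_) (not_lt.2 h1)
  rw [hcard'] at hsum hdeg
  rw [hS] at hdeg
  zify at hsum h4 ⊢
  push_cast at hdeg
  nlinarith

theorem lemma4p1 (ε : ℕ) (hε : 1 ≤ ε) (hε3 : ε ≠ 3)
    (h : HeawoodListProperty.{u, v} ε (heawood ε + 1)) :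
    ∀ n : ℕ, HeawoodListProperty.{u, v} ε n := by
  intro n
  exact heawoodListProperty hε hε3 n
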